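/- All logarithms are to base $2$. Let $1\le\delta<2$ be real and let $\ell\ge 1$ be a fixed integer. **Model.** An algorithm that probes in $\ell$ rounds gets as input an unknown graph $G$ on the vertex set $\{1,\dots,n\}$. In round $i=1,\dots,\ell$ it chooses, on the basis of the answers received in the earlier rounds, a set $E_i$ of pairs of vertices, and it is then told for every pair in $E_i$ whether it is an edge of $G$. After round $\ell$ it outputs a set of vertices. Computation is unrestricted, and the algorithm may use randomness that is independent of $G$. It makes at most $T$ probes if $\sum_{i=1}^{\ell}|E_i|\le T$ on every input and for every outcome of its randomness. Let $\alpha_\star(\delta,\ell)$ be the supremum of the real numbers $\alpha$ such that for infinitely many $n$ there is an algorithm that makes at most $n^{\delta}$ probes in $\ell$ rounds and that, with probability at least $1/2$ over $G\sim G_{n,1/2}$ and its own randomness, outputs a set that is a clique of $G$ with at least $\alpha\log n$ vertices. (In particular, upper bounds on $\alpha_\star$ also hold for the supremum of the $\alpha$ that are achieved for all sufficiently large $n$.) For $0\le\beta\le 1$ define $$f(\beta,\delta)=\begin{cases}(2-\delta)\sqrt{1-\beta}+\delta-1, & 0\le\beta\le \tfrac{16}{25},\\[2pt] 1-\bigl(1-\tfrac{\delta}{2}\bigr)\sqrt{\beta},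 & \tfrac{16}{25}\le\beta\le 1,\end{cases}$$ and let $\Delta_{\ell-1}=\{(\beta_1,\dots,\beta_\ell): \beta_j\ge 0,\ \sum_{j=1}^{\ell}\beta_j=1\}$. **Theorem.** For every $1\le\delta<2$ and every integer $\ell\ge1$, $$\alpha_\star(\delta,\ell)\ \le\ \min_{\beta\in\Delta_{\ell-1}}\ \max_{1\le i\le \ell}\ \frac{2f\bigl(\sum_{j=1}^{i}\beta_j,\delta\bigr)}{\sum_{j=i}^{\ell}\beta_j},$$ where a quotient with denominator $0$ is read as $+\infty$ (the numerators are positive), and the minimum is attained. In particular, there is a $\beta\in\Delta_{\ell-1}$ (depending on $\delta$ and $\ell$) for which the maximum over $i$ is at most $2-\delta\left(\frac{2-\delta}{2}\right)^{\ell}$, and hence $$\alpha_\star(\delta,\ell)\ \le\ 2-\delta\left(\frac{2-\delta}{2}\right)^{\ell}.$$ -/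

import Mathlib

open scoped ENNReal

namespace CliqueProbing

/-- A pair `(i, j)` with `i < j` of vertices of the vertex set `Fin n`: an entry of the adjacency
matrix that can be probed. -/
abbrev VertexPair (n : ℕ) : Type := {e : Fin n × Fin n // e.1 < e.2}

/-- What one round of probes reveals: each pair is marked with `none` if it was not probed in
the round, and otherwise with `some b`, where `b` tells whether it is an edge. -/
abbrev Answers (n : ℕ) : Type := VertexPair n → Option Bool

open Classical in
/-- The answers that the graph `G` gives to the set `E` of probes. -/
noncomputable def reveal {n : ℕ} (G : SimpleGraph (Fin n)) (E : Finset (VertexPair n)) :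
    Answers n :=
  fun e => if e ∈ E then some (decide (G.Adj e.1.1 e.1.2)) else none

/-- A deterministic algorithm that probes a graph with vertex set `Fin n` in `ℓ` rounds. In each
round it chooses, on the basis of the answers of the earlier rounds, a set of pairs, which are
probed in parallel. After the last round it outputs a set of vertices. There is no restriction on
the computation of these choices. -/
structure ProbeAlgorithm (n ℓ : ℕ) where
  /-- the set of pairs probed in round `i`, given the answers of the rounds before `i` -/
  probe : (i : Fin ℓ) → (Fin i → Answers n) → Finset (VertexPair n)
  /-- the set of vertices that is output, given the answers of all rounds -/
  output : (Fin ℓ → Answers n) → Finset (Fin n)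

namespace ProbeAlgorithm

variable {n ℓ : ℕ}

/-- The answers of the first `k` rounds when the algorithm is run on the graph `G`. -/
noncomputable def history (A : ProbeAlgorithm n ℓ) (G : SimpleGraph (Fin n)) :
    (k : ℕ) → k ≤ ℓ → (Fin k → Answers n)
  | 0, _ => Fin.elim0
  | k + 1, h =>
    Fin.snoc (α := fun _ => Answers n) (A.history G k (Nat.le_of_succ_le h))
      (reveal G (A.probe ⟨k, h⟩ (A.history G k (Nat.le_of_succ_le h))))

/-- The set of pairs that the algorithm probes in round `i` when it is run on `G`. -/
noncomputable def probesAt (A : ProbeAlgorithm n ℓ) (G : SimpleGraph (Fin n)) (i : Fin ℓ) :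
    Finset (VertexPair n) :=
  A.probe i (A.history G i i.isLt.le)

/-- The set of vertices that the algorithm outputs when it is run on `G`. -/
noncomputable def result (A : ProbeAlgorithm n ℓ) (G : SimpleGraph (Fin n)) : Finset (Fin n) :=
  A.output (A.history G ℓ le_rfl)

/-- On every input graph, the algorithm makes at most `T` probes in total. -/
def ProbesAtMost (A : ProbeAlgorithm n ℓ) (T : ℝ) : Prop :=
  ∀ G : SimpleGraph (Fin n), ((∑ i : Fin ℓ, (A.probesAt G i).card : ℕ) : ℝ) ≤ T

/-- The input graphs on which the algorithm outputs a clique with at least `s` vertices. -/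
def successSet (A : ProbeAlgorithm n ℓ) (s : ℝ) : Set (SimpleGraph (Fin n)) :=
  {G | G.IsClique (A.result G : Set (Fin n)) ∧ s ≤ ((A.result G).card : ℝ)}

end ProbeAlgorithm

/-- The edge probability `1/2`. -/
noncomputable def half : unitInterval := ⟨1 / 2, by norm_num, by norm_num⟩

/-- The probability that a randomized algorithm outputs a clique with at least `s` vertices in a
random graph `G(n, 1/2)`. A randomized algorithm is a random choice, independent of the input
graph, of a deterministic algorithm. -/
noncomputable def successProb {n ℓ : ℕ} (P : PMF (ProbeAlgorithm n ℓ)) (s : ℝ) : ℝ≥0∞ :=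
  ∑' A : ProbeAlgorithm n ℓ, P A * SimpleGraph.binomialRandom (Fin n) half (A.successSet s)

/-- Some randomized algorithm makes at most `n ^ δ` probes in `ℓ` rounds, and with probability at
least `1/2` outputs a clique of size at least `α log₂ n` in a random graph `G(n, 1/2)`. -/
def Achievable (δ : ℝ) (ℓ : ℕ) (α : ℝ) (n : ℕ) : Prop :=
  ∃ P : PMF (ProbeAlgorithm n ℓ),
    (∀ A ∈ P.support, A.ProbesAtMost ((n : ℝ) ^ δ)) ∧
    1 / 2 ≤ successProb P (α * Real.logb 2 n)

/-- The threshold `α⋆(δ, ℓ)`: the supremum of the `α` that can be achieved for arbitrarily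
large `n`. It dominates the supremum of the `α` that can be achieved for all large `n`. -/
noncomputable def alphaStar (δ : ℝ) (ℓ : ℕ) : EReal :=
  ⨆ α ∈ {α : ℝ | ∃ᶠ n : ℕ in Filter.atTop, Achievable δ ℓ α n}, (α : EReal)

/-- The function `f(β, δ)`, for `0 ≤ β ≤ 1` and `1 ≤ δ < 2`. -/
noncomputable def f (β δ : ℝ) : ℝ :=
  if β ≤ 16 / 25 then (2 - δ) * √(1 - β) + δ - 1 else 1 - (1 - δ / 2) * √β

/-- The quantity `max_i 2 f(β_1 + ... + β_i, δ) / (β_i + ... + β_ℓ)`. The values are in `[0, ∞]`,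
and a quotient of a positive number by `0` is `∞`. -/
noncomputable def cliqueBound (δ : ℝ) {ℓ : ℕ} (β : Fin ℓ → ℝ) : ℝ≥0∞ :=
  ⨆ i : Fin ℓ, ENNReal.ofReal (2 * f (∑ j ∈ Finset.Iic i, β j) δ) /
    ENNReal.ofReal (∑ j ∈ Finset.Ici i, β j)

end CliqueProbing

/-!
The number of cliques that an adaptive algorithm could find is bounded by a union bound over its
rounds. Fix `β` in the simplex, with partial sums `B i`, and let `K` be a clique with
`k ≥ α * logb 2 n` vertices that is part of the output. Unless a positive proportion of the pairs of
`K` is never probed (in which case `K` is a clique only with exponentially small probability), there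
is a first round `i` by whose end about the proportion `B (i + 1)` of the pairs of `K` is
probed (rounds are numbered from `0`); at its start, at least the proportion `1 - B i` is unprobed.

* The pairs that are probed up to and including round `i` are determined by the answers of the
  earlier rounds, and they form a graph with at most `n ^ δ` edges. In such a graph at most
  `n ^ (k * (f (B (i + 1)) δ + o(1)))` sets of `k` vertices contain the proportion `B (i + 1)`
  of their pairs. Indeed, by the Erdős–Gallai bound (`sum_degree_le_of_no_matching`), such a
  set has a matching with `x * k` edges, where `1 - (2 - δ) * x` is about `f (B (i + 1)) δ`
  (`exists_fraction_of_f_lt`), and `x * k` edges and `(1 - 2 * x) * k` further vertices can be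
  chosen in at most `n ^ (δ * x * k + (1 - 2 * x) * k)` ways (`card_containing_matched_le`,
  `card_dense_le`).
* Given the answers of the rounds before `i`, the unprobed pairs are independent fair coins, so that
  each candidate is a clique with probability at most `2 ^ (-(1 - B i) * k * (k - 1) / 2)`
  (`card_clique_mul_le`).

So the success probability tends to `0` if `2 * f (B (i + 1)) δ < α * (1 - B i)` for all `i`
(`eventually_not_achievable`). This shows that `α⋆` is at most `cliqueBound δ β` for every `β`. The
minimum over `β` exists by compactness, and an explicit `β` with geometrically growing partial sums
gives the closed form, through the linear bound `f_le_linear`.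
-/

namespace CliqueProbing

/-! ### Matchings and the Erdős–Gallai bound -/

/-- `Matched G S`: the vertices of `S` can be partitioned into edges of `G`, that is, `S` is the
vertex set of a matching of `G`. -/
inductive Matched {V : Type*} [DecidableEq V] (G : SimpleGraph V) : Finset V → Prop
  | empty : Matched G ∅
  | insert_edge {S : Finset V} {u v : V} (hS : Matched G S) (hu : u ∉ S) (hv : v ∉ S)
      (h : G.Adj u v) : Matched G (insert u (insert v S))

section Matching

variable {V : Type*} [DecidableEq V] {G : SimpleGraph V} {S K : Finset V} {u v : V} {ν : ℕ}

open Classical in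
/-- The exchange step for matchings: if `u` and `v` send more than `#S` edges into the matched set
`S`, then they send at least three edges to some matching edge `xy`, which can therefore be replaced
by two edges that cover `u, v, x, y`. -/
lemma Matched.augment (hS : Matched G S) (hu : u ∉ S) (hv : v ∉ S) (huv : u ≠ v)
    (hdeg : S.card + 1 ≤ (S.filter (G.Adj u)).card + (S.filter (G.Adj v)).card) :
    Matched G (insert u (insert v S)) := by
  induction hS with
  | empty => simp at hdeg
  | @insert_edge S x y hS hx hy hxy ih =>
    simp only [Finset.mem_insert, not_or] at hu hv
    have hne := hxy.ne
    have hxS : x ∉ insert y S := by simp [hne, hx]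
    rw [Finset.card_insert_of_notMem hxS, Finset.card_insert_of_notMem hy] at hdeg
    have key : ∀ w : V, ((insert x (insert y S)).filter (G.Adj w)).card =
        (if G.Adj w x then 1 else 0) + (if G.Adj w y then 1 else 0) +
          (S.filter (G.Adj w)).card := by
      intro w
      simp only [Finset.filter_insert]
      split_ifs with h1 h2 h2 <;> simp [hne, hx, hy] <;> omega
    rw [key, key] at hdeg
    have hbase : (S.card + 1 ≤ (S.filter (G.Adj u)).card + (S.filter (G.Adj v)).card) ∨
        (G.Adj u x ∧ G.Adj v y) ∨ (G.Adj u y ∧ G.Adj v x) := by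
      generalize (S.filter (G.Adj u)).card = p, (S.filter (G.Adj v)).card = q at hdeg ⊢
      clear ih key
      split_ifs at hdeg <;> first | exact .inl (by omega) | tauto
    have e : ∀ a b c d : V, ({a, b} : Finset V) ∪ {c, d} = {x, y} ∪ {u, v} →
        insert a (insert b (insert c (insert d S))) =
          insert u (insert v (insert x (insert y S))) := by
      intro a b c d h
      calc insert a (insert b (insert c (insert d S))) = (({a, b} : Finset V) ∪ {c, d}) ∪ S := by
            simp only [Finset.insert_union, Finset.singleton_union]
        _ = _ := by
            rw [h, Finset.union_comm {x, y}]
            simp only [Finset.insert_union, Finset.singleton_union]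
    rcases hbase with h | ⟨h1, h2⟩ | ⟨h1, h2⟩
    · have := (ih hu.2.2 hv.2.2 h).insert_edge (u := x) (v := y)
        (by simp [Ne.symm hu.1, Ne.symm hv.1, hx])
        (by simp [Ne.symm hu.2.1, Ne.symm hv.2.1, hy]) hxy
      rwa [e x y u v rfl] at this
    · have := (hS.insert_edge hv.2.2 hy h2).insert_edge (u := u) (v := x)
        (by simp [huv, hu]) (by simp [Ne.symm hv.1, hne, hx]) h1
      rwa [e _ _ _ _ (by grind)] at this
    · have := (hS.insert_edge hv.2.2 hx h2).insert_edge (u := u) (v := y)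
        (by simp [huv, hu]) (by simp [Ne.symm hv.2.1, hne.symm, hy]) h1
      rwa [e _ _ _ _ (by grind)] at this

lemma Matched.of_sup_edge (huv : u ≠ v) (hS : Matched (G ⊔ SimpleGraph.edge u v) S) :
    Matched G S ∨ (u ∈ S ∧ v ∈ S ∧ Matched G (S \ {u, v})) := by
  induction hS with
  | empty => exact .inl .empty
  | @insert_edge S a b hS ha hb h ih =>
    by_cases hab : G.Adj a b
    · rcases ih with ih | ⟨hu, hv, ih⟩
      · exact .inl (ih.insert_edge ha hb hab)
      · refine .inr ⟨by simp [hu], by simp [hv], ?_⟩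
        have := ih.insert_edge (u := a) (v := b) (by simp [ha]) (by simp [hb]) hab
        convert this using 1
        ext z
        simp only [Finset.mem_sdiff, Finset.mem_insert, Finset.mem_singleton]
        grind
    · have h' : (a = u ∧ b = v) ∨ (a = v ∧ b = u) := by
        simp only [SimpleGraph.sup_adj, hab, SimpleGraph.edge_adj, false_or] at h
        tauto
      have hSuv : u ∉ S ∧ v ∉ S := by rcases h' with ⟨rfl, rfl⟩ | ⟨rfl, rfl⟩ <;> simp [ha, hb]
      have ih : Matched G S := by
        rcases ih with ih | ⟨hu, -⟩
        · exact ih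
        · exact absurd hu hSuv.1
      refine .inr ?_
      have e : insert a (insert b S) \ {u, v} = S := by
        ext z
        simp only [Finset.mem_sdiff, Finset.mem_insert, Finset.mem_singleton]
        grind
      rw [e]
      refine ⟨?_, ?_, ih⟩ <;> rcases h' with ⟨rfl, rfl⟩ | ⟨rfl, rfl⟩ <;> simp

lemma matched_of_isClique (hK : G.IsClique (K : Set V)) (t : ℕ) (ht : 2 * t ≤ K.card) :
    ∃ S ⊆ K, S.card = 2 * t ∧ Matched G S := by
  induction t with
  | zero => exact ⟨∅, by simp, by simp, .empty⟩
  | succ t ih =>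
    obtain ⟨S, hSK, hS, hM⟩ := ih (by omega)
    have : 1 < (K \ S).card := by rw [Finset.card_sdiff_of_subset hSK]; omega
    obtain ⟨a, ha, b, hb, hab⟩ := Finset.one_lt_card.1 this
    simp only [Finset.mem_sdiff] at ha hb
    refine ⟨insert a (insert b S), ?_, ?_, hM.insert_edge ha.2 hb.2 (hK ha.1 hb.1 hab)⟩
    · grind
    · rw [Finset.card_insert_of_notMem (by simp [hab, ha.2]),
        Finset.card_insert_of_notMem hb.2]; omega

open Classical in
/-- An edge-maximal graph without a matching of size `ν + 1` inside `K` satisfies an Ore-type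
condition. -/
lemma degree_add_degree_le (hν : ∀ S ⊆ K, S.card = 2 * (ν + 1) → ¬ Matched G S)
    (hu : u ∈ K) (hv : v ∈ K) (huv : u ≠ v)
    (hmax : ∃ S ⊆ K, S.card = 2 * (ν + 1) ∧ Matched (G ⊔ SimpleGraph.edge u v) S) :
    (K.filter (G.Adj u)).card + (K.filter (G.Adj v)).card ≤ 2 * ν := by
  obtain ⟨S, hSK, hS, hM⟩ := hmax
  obtain hM | ⟨huS, hvS, hM⟩ := hM.of_sup_edge huv
  · exact absurd hM (hν S hSK hS)
  set S' := S \ {u, v} with hS'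
  have hsub : ({u, v} : Finset V) ⊆ S := by grind
  have hcard : S'.card = 2 * ν := by
    rw [hS', Finset.card_sdiff_of_subset hsub, Finset.card_pair huv]; omega
  have huS' : u ∉ S' := by simp [hS']
  have hvS' : v ∉ S' := by simp [hS']
  have hS'K : S' ⊆ K := Finset.sdiff_subset.trans hSK
  have hN : ∀ w : V, w ∈ K → w ∉ S' → K.filter (G.Adj w) = S'.filter (G.Adj w) := by
    intro w hw hwS
    ext z
    simp only [Finset.mem_filter]
    refine ⟨fun ⟨hz, hwz⟩ => ⟨?_, hwz⟩, fun ⟨hz, hwz⟩ => ⟨hS'K hz, hwz⟩⟩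
    by_contra hzS
    refine hν _ ?_ ?_ (hM.insert_edge hwS hzS hwz)
    · grind
    · rw [Finset.card_insert_of_notMem (by simp [hwz.ne, hwS]),
        Finset.card_insert_of_notMem hzS]; omega
  rw [hN u hu huS', hN v hv hvS']
  by_contra hlt
  refine hν _ ?_ ?_ (hM.augment huS' hvS' huv (by omega))
  · grind
  · rw [Finset.card_insert_of_notMem (by simp [huv, huS']),
        Finset.card_insert_of_notMem hvS']; omega

open Classical in
/-- The degree count. Among the nonadjacent pairs, one with the largest degree sum `a + b`, where
`a ≤ b`, is chosen. The vertices not adjacent to the one of degree `b` have degree at most `a`, and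
those not adjacent to the one of degree `a` have degree at most `b`. -/
lemma sum_degree_le_of_ore (hore : ∀ u ∈ K, ∀ v ∈ K, u ≠ v → ¬ G.Adj u v →
      (K.filter (G.Adj u)).card + (K.filter (G.Adj v)).card ≤ 2 * ν)
    (hK : ¬ G.IsClique (K : Set V)) :
    ((∑ u ∈ K, (K.filter (G.Adj u)).card : ℕ) : ℝ) ≤
      max (4 * (ν : ℝ) ^ 2) (2 * K.card * ν - (ν : ℝ) ^ 2) + 2 * ν := by
  set d : V → ℕ := fun u => (K.filter (G.Adj u)).card with hd
  set P := (K ×ˢ K).filter (fun p : V × V => p.1 ≠ p.2 ∧ ¬ G.Adj p.1 p.2) with hP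
  have hPne : P.Nonempty := by
    simp only [SimpleGraph.IsClique, Set.Pairwise] at hK
    push Not at hK
    obtain ⟨u, hu, v, hv, h⟩ := hK
    exact ⟨(u, v), by simp [hP]; exact ⟨⟨hu, hv⟩, h⟩⟩
  obtain ⟨⟨u, v⟩, huvP, hmaxP⟩ := P.exists_max_image (fun p => d p.1 + d p.2) hPne
  -- by symmetry the first vertex has the smaller degree
  wlog hle : d u ≤ d v generalizing u v
  · refine this v u ?_ ?_ (by omega)
    · simp only [hP, Finset.mem_filter, Finset.mem_product] at huvP ⊢
      exact ⟨⟨huvP.1.2, huvP.1.1⟩, huvP.2.1.symm, fun h => huvP.2.2 h.symm⟩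
    · intro p hp
      have := hmaxP p hp
      simp only at this ⊢
      omega
  have hmax : ∀ w ∈ K, ∀ z ∈ K, w ≠ z → ¬ G.Adj w z → d w + d z ≤ d u + d v := by
    intro w hw z hz hwz h
    exact hmaxP (w, z) (by simp [hP, hw, hz, hwz, h])
  simp only [hP, Finset.mem_filter, Finset.mem_product] at huvP
  obtain ⟨⟨hu, hv⟩, huv, hadj⟩ := huvP
  have hsum := hore u hu v hv huv hadj
  have hdlt : ∀ w ∈ K, d w + 1 ≤ K.card := by
    intro w hw
    have : K.filter (G.Adj w) ⊂ K :=
      Finset.filter_ssubset.2 ⟨w, hw, by simp⟩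
    exact Finset.card_lt_card this
  set W₁ := K.filter (fun w => w ≠ v ∧ ¬ G.Adj v w) with hW₁
  set W₂ := K.filter (fun w => ¬ G.Adj u w) with hW₂
  have hcW₂ : d u + W₂.card = K.card := Finset.card_filter_add_card_filter_not _
  have hcW₁ : d v + W₁.card + 1 = K.card := by
    have h1 : d v + (K.filter (fun w => ¬ G.Adj v w)).card = K.card :=
      Finset.card_filter_add_card_filter_not _
    have h2 : W₁ = (K.filter (fun w => ¬ G.Adj v w)).erase v := by
      ext z; simp [hW₁]; tauto
    have h3 : v ∈ K.filter (fun w => ¬ G.Adj v w) := by simp [hv]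
    rw [h2, Finset.card_erase_of_mem h3]
    have := Finset.card_pos.2 ⟨v, h3⟩
    omega
  have hv' := hdlt v hv
  have hpt : ∀ w ∈ K, (d w : ℝ) ≤ (K.card - 1) - (if ¬ G.Adj u w then (K.card - 1 - d v : ℝ) else 0)
      - (if w ≠ v ∧ ¬ G.Adj v w then (d v - d u : ℝ) else 0) := by
    intro w hw
    have h0 : (d w : ℝ) + 1 ≤ K.card := by exact_mod_cast hdlt w hw
    have hv'' : (d v : ℝ) + 1 ≤ K.card := by exact_mod_cast hv'
    have h1 : ¬ G.Adj u w → (d w : ℝ) ≤ d v := by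
      intro h
      by_cases hwu : w = u
      · rw [hwu]; exact_mod_cast hle
      · have := hmax w hw u hu hwu (fun h' => h h'.symm)
        exact_mod_cast (by omega : d w ≤ d v)
    have h2 : w ≠ v ∧ ¬ G.Adj v w → (d w : ℝ) ≤ d u := by
      rintro ⟨hwv, h⟩
      have := hmax w hw v hv hwv (fun h' => h h'.symm)
      exact_mod_cast (by omega : d w ≤ d u)
    by_cases ha : G.Adj u w <;> by_cases hb : w ≠ v ∧ ¬ G.Adj v w
    · rw [if_neg (not_not.2 ha), if_pos hb]; linarith [h2 hb]
    · rw [if_neg (not_not.2 ha), if_neg hb]; linarith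
    · rw [if_pos ha, if_pos hb]; linarith [h2 hb]
    · rw [if_pos ha, if_neg hb]; linarith [h1 ha]
  have htot := Finset.sum_le_sum hpt
  rw [Finset.sum_sub_distrib, Finset.sum_sub_distrib, ← Finset.sum_filter, ← Finset.sum_filter]
    at htot
  simp only [Finset.sum_const, nsmul_eq_mul, ← hW₁, ← hW₂] at htot
  have e1 : (W₁.card : ℝ) = K.card - 1 - d v := by
    rw [← hcW₁]; push_cast; ring
  have e2 : (W₂.card : ℝ) = K.card - d u := by
    rw [← hcW₂]; push_cast; ring
  rw [e1, e2] at htot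
  push_cast
  have ha : (0 : ℝ) ≤ d u := Nat.cast_nonneg _
  have hab : (d u : ℝ) ≤ d v := by exact_mod_cast hle
  have habν : (d u : ℝ) + d v ≤ 2 * ν := by exact_mod_cast hsum
  refine htot.trans ?_
  generalize (d u : ℝ) = a at *
  generalize (d v : ℝ) = b at *
  generalize (K.card : ℝ) = k at *
  -- the bound is increasing in `b ≥ a`, so that `b` may be replaced by `2ν - a`
  have step : k * (k - 1) - (k - a) * (k - 1 - b) - (k - 1 - b) * (b - a) ≤
      2 * k * a + 3 * a ^ 2 - 8 * a * ν + 4 * (ν : ℝ) ^ 2 + 2 * ν := by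
    nlinarith [mul_nonneg (by linarith : (0:ℝ) ≤ 2 * ν - a - b)
      (by linarith : (0:ℝ) ≤ (2 * ν - a) + b - 2 * a)]
  refine step.trans ?_
  -- what is left is convex in `a`, and is compared with its values at `a = 0` and `a = ν`
  have haν : a ≤ ν := by linarith
  rcases le_total (2 * k + 3 * a - 8 * ν) 0 with h | h
  · have := mul_nonneg ha (by linarith : 0 ≤ -(2 * k + 3 * a - 8 * ν))
    have := le_max_left (4 * (ν : ℝ) ^ 2) (2 * k * ν - (ν : ℝ) ^ 2)
    nlinarith
  · have := mul_nonneg (by linarith : 0 ≤ (ν : ℝ) - a)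
      (by linarith : 0 ≤ 2 * k + 3 * a - 8 * ν + 3 * ν)
    have := le_max_right (4 * (ν : ℝ) ^ 2) (2 * k * ν - (ν : ℝ) ^ 2)
    nlinarith

open Classical in
/-- The Erdős–Gallai bound: if the graph induced on `K` has no matching with `ν + 1` edges, then its
degree sum is at most `max (4 * ν ^ 2) (2 * #K * ν - ν ^ 2) + 2 * ν`. -/
theorem sum_degree_le_of_no_matching [Finite V]
    (hν : ∀ S ⊆ K, S.card = 2 * (ν + 1) → ¬ Matched G S) :
    ((∑ u ∈ K, (K.filter (G.Adj u)).card : ℕ) : ℝ) ≤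
      max (4 * (ν : ℝ) ^ 2) (2 * K.card * ν - (ν : ℝ) ^ 2) + 2 * ν := by
  -- adding edges only increases the degrees, so that `G` may be taken edge-maximal
  obtain ⟨H, hGH, hH⟩ := Set.Finite.exists_le_maximal
    (s := {H : SimpleGraph V | ∀ S ⊆ K, S.card = 2 * (ν + 1) → ¬ Matched H S})
    (Set.toFinite _) hν
  have hmono : ((∑ u ∈ K, (K.filter (G.Adj u)).card : ℕ) : ℝ) ≤
      (∑ u ∈ K, (K.filter (H.Adj u)).card : ℕ) := by
    refine Nat.cast_le.2 (Finset.sum_le_sum fun u _ => Finset.card_le_card fun w hw => ?_)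
    rw [Finset.mem_filter] at hw ⊢
    exact ⟨hw.1, hGH hw.2⟩
  refine hmono.trans ?_
  by_cases hK : H.IsClique (K : Set V)
  · have hk : K.card ≤ 2 * ν + 1 := by
      by_contra hk
      obtain ⟨S, hS, hc, hM⟩ := matched_of_isClique hK (ν + 1) (by omega)
      exact hH.prop S hS hc hM
    have hle : ∑ u ∈ K, (K.filter (H.Adj u)).card ≤ (2 * ν + 1) * (2 * ν) := by
      calc ∑ u ∈ K, (K.filter (H.Adj u)).card ≤ ∑ u ∈ K, 2 * ν := by
            refine Finset.sum_le_sum fun u hu => ?_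
            have : K.filter (H.Adj u) ⊂ K := Finset.filter_ssubset.2 ⟨u, hu, by simp⟩
            have := Finset.card_lt_card this
            omega
        _ = K.card * (2 * ν) := by simp
        _ ≤ _ := by gcongr
    calc ((∑ u ∈ K, (K.filter (H.Adj u)).card : ℕ) : ℝ) ≤ ((2 * ν + 1) * (2 * ν) : ℕ) := by
          exact_mod_cast hle
      _ = 4 * (ν : ℝ) ^ 2 + 2 * ν := by push_cast; ring
      _ ≤ _ := by gcongr; exact le_max_left _ _
  · refine sum_degree_le_of_ore (fun u hu v hv huv hadj => ?_) hK
    refine degree_add_degree_le hH.prop hu hv huv ?_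
    by_contra hcon
    push Not at hcon
    have := hH.le_of_ge (y := H ⊔ SimpleGraph.edge u v) hcon le_sup_left
    exact hadj (this (by simp [SimpleGraph.edge_adj, huv]))

end Matching

/-! ### Dense vertex sets in a graph with few edges -/

section Counting

variable {n : ℕ}

/-- The graph whose edges are the vertex pairs in `E`. -/
def pairGraph (E : Finset (VertexPair n)) : SimpleGraph (Fin n) where
  Adj u v := ∃ e ∈ E, (e.1.1 = u ∧ e.1.2 = v) ∨ (e.1.1 = v ∧ e.1.2 = u)
  symm := ⟨fun _ _ ⟨e, he, h⟩ => ⟨e, he, h.symm⟩⟩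
  loopless := ⟨fun _ ⟨e, _, h⟩ => by
    rcases h with ⟨h1, h2⟩ | ⟨h1, h2⟩ <;> exact e.2.ne (h1.trans h2.symm)⟩

/-- The vertex pairs in `E` with both ends in `K`. -/
def pairsIn (E : Finset (VertexPair n)) (K : Finset (Fin n)) : Finset (VertexPair n) :=
  E.filter fun e => e.1.1 ∈ K ∧ e.1.2 ∈ K

lemma mem_pairsIn {E : Finset (VertexPair n)} {K : Finset (Fin n)} {e : VertexPair n} :
    e ∈ pairsIn E K ↔ e ∈ E ∧ e.1.1 ∈ K ∧ e.1.2 ∈ K := by simp [pairsIn]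

lemma pairGraph_adj_iff (E : Finset (VertexPair n)) (e : VertexPair n) :
    (pairGraph E).Adj e.1.1 e.1.2 ↔ e ∈ E := by
  refine ⟨fun ⟨e', he', h⟩ => ?_, fun h => ⟨e, h, .inl ⟨rfl, rfl⟩⟩⟩
  rcases h with ⟨h1, h2⟩ | ⟨h1, h2⟩
  · have : e' = e := Subtype.ext (Prod.ext h1 h2)
    rwa [← this]
  · have h3 := e.2
    have h4 := e'.2
    rw [h1, h2] at h4
    exact absurd h3 h4.not_gt

lemma graph_ext_pairs {G G' : SimpleGraph (Fin n)}
    (h : ∀ e : VertexPair n, G.Adj e.1.1 e.1.2 ↔ G'.Adj e.1.1 e.1.2) : G = G' := by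
  ext u v
  rcases lt_trichotomy u v with huv | rfl | huv
  · exact h ⟨(u, v), huv⟩
  · simp
  · rw [G.adj_comm, G'.adj_comm]
    exact h ⟨(v, u), huv⟩

lemma isClique_iff_pairs {G : SimpleGraph (Fin n)} {K : Finset (Fin n)} :
    G.IsClique (K : Set (Fin n)) ↔ ∀ e ∈ pairsIn .univ K, G.Adj e.1.1 e.1.2 := by
  refine ⟨fun h e he => ?_, fun h u hu v hv huv => ?_⟩
  · rw [mem_pairsIn] at he
    exact h he.2.1 he.2.2 e.2.ne
  · rcases lt_or_gt_of_ne huv with huv | huv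
    · exact h ⟨(u, v), huv⟩ (mem_pairsIn.2 ⟨Finset.mem_univ _, hu, hv⟩)
    · exact (h ⟨(v, u), huv⟩ (mem_pairsIn.2 ⟨Finset.mem_univ _, hv, hu⟩)).symm

lemma two_mul_card_pairsIn_univ (K : Finset (Fin n)) :
    2 * (pairsIn .univ K).card = K.card * (K.card - 1) := by
  have h1 : (pairsIn .univ K).card + (pairsIn .univ K).card = K.offDiag.card := by
    rw [← Finset.card_filter_add_card_filter_not (s := K.offDiag) (fun p => p.1 < p.2)]
    congr 1
    · refine Finset.card_bij (fun e _ => e.1) (fun e he => ?_) (fun _ _ _ _ h => Subtype.ext h)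
        (fun p hp => ?_)
      · rw [mem_pairsIn] at he
        simp only [Finset.mem_filter, Finset.mem_offDiag]
        exact ⟨⟨he.2.1, he.2.2, e.2.ne⟩, e.2⟩
      · simp only [Finset.mem_filter, Finset.mem_offDiag] at hp
        exact ⟨⟨p, hp.2⟩, mem_pairsIn.2 ⟨Finset.mem_univ _, hp.1.1, hp.1.2.1⟩, rfl⟩
    · refine Finset.card_bij (fun e _ => e.1.swap) (fun e he => ?_)
        (fun _ _ _ _ h => Subtype.ext (Prod.swap_injective h)) (fun p hp => ?_)
      · rw [mem_pairsIn] at he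
        simp only [Finset.mem_filter, Finset.mem_offDiag, Prod.fst_swap, Prod.snd_swap, not_lt]
        exact ⟨⟨he.2.2, he.2.1, e.2.ne'⟩, e.2.le⟩
      · simp only [Finset.mem_filter, Finset.mem_offDiag, not_lt] at hp
        exact ⟨⟨p.swap, lt_of_le_of_ne hp.2 (Ne.symm hp.1.2.2)⟩,
          mem_pairsIn.2 ⟨Finset.mem_univ _, hp.1.2.1, hp.1.1⟩, Prod.swap_swap p⟩
  rw [two_mul, h1, Finset.offDiag_card, Nat.mul_sub, mul_one]

open Classical in
lemma two_mul_card_pairsIn_le (E : Finset (VertexPair n)) (K : Finset (Fin n)) :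
    2 * (pairsIn E K).card ≤ ∑ u ∈ K, (K.filter ((pairGraph E).Adj u)).card := by
  rw [← Finset.card_sigma]
  set D := K.sigma fun u => K.filter ((pairGraph E).Adj u)
  let φ : VertexPair n → Bool → (_ : Fin n) × Fin n := fun e b =>
    if b then ⟨e.1.1, e.1.2⟩ else ⟨e.1.2, e.1.1⟩
  have : (pairsIn E K ×ˢ (Finset.univ : Finset Bool)).card ≤ D.card := by
    refine Finset.card_le_card_of_injOn (fun p => φ p.1 p.2) ?_ ?_
    · rintro ⟨e, b⟩ he
      simp only [Finset.coe_product, Set.mem_prod, Finset.mem_coe, mem_pairsIn] at he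
      have hadj := (pairGraph_adj_iff E e).2 he.1.1
      cases b
      · simp only [φ, D, Finset.mem_coe, Finset.mem_sigma, Finset.mem_filter]
        exact ⟨he.1.2.2, he.1.2.1, hadj.symm⟩
      · simp only [φ, D, Finset.mem_coe, Finset.mem_sigma, Finset.mem_filter]
        exact ⟨he.1.2.1, he.1.2.2, hadj⟩
    · rintro ⟨e, b⟩ - ⟨e', b'⟩ - h
      have h1 := e.2
      have h2 := e'.2
      cases b <;> cases b' <;>
        simp only [φ, if_true, Bool.false_eq_true, if_false, Sigma.mk.injEq, heq_eq_eq] at h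
      · rw [Subtype.ext (Prod.ext h.2 h.1)]
      · rw [h.1, h.2] at h1; exact absurd h1 h2.not_gt
      · rw [h.1, h.2] at h1; exact absurd h1 h2.not_gt
      · rw [Subtype.ext (Prod.ext h.1 h.2)]
  simpa [mul_comm] using this

open Classical in
/-- A set of `2 * t` vertices that is matched by `E` is determined by the `t` edges of a
matching. -/
lemma card_matched_le (E : Finset (VertexPair n)) (t : ℕ) :
    (Finset.univ.filter fun S : Finset (Fin n) => S.card = 2 * t ∧ Matched (pairGraph E) S).card ≤
      E.card ^ t := by
  induction t with
  | zero =>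
    rw [pow_zero, Finset.card_le_one]
    intro S hS S' hS'
    simp only [mul_zero, Finset.card_eq_zero, Finset.mem_filter] at hS hS'
    rw [hS.2.1, hS'.2.1]
  | succ t ih =>
    set F := Finset.univ.filter fun S : Finset (Fin n) => S.card = 2 * t ∧ Matched (pairGraph E) S
    calc _ ≤ ((E ×ˢ F).image fun p => insert p.1.1.1 (insert p.1.1.2 p.2)).card := by
          refine Finset.card_le_card fun S hS => ?_
          simp only [Finset.mem_filter, Finset.mem_univ, true_and] at hS
          obtain ⟨hc, hM⟩ := hS
          cases hM with
          | empty => simp at hc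
          | @insert_edge S u v hS hu hv h =>
            have hF : S ∈ F := by
              rw [Finset.card_insert_of_notMem (by simp [h.ne, hu]),
                Finset.card_insert_of_notMem hv] at hc
              simp only [F, Finset.mem_filter, Finset.mem_univ, true_and]
              exact ⟨by omega, hS⟩
            obtain ⟨e, he, ⟨rfl, rfl⟩ | ⟨rfl, rfl⟩⟩ := h
            · exact Finset.mem_image.2 ⟨(e, S), Finset.mem_product.2 ⟨he, hF⟩, rfl⟩
            · exact Finset.mem_image.2 ⟨(e, S), Finset.mem_product.2 ⟨he, hF⟩,
                Finset.insert_comm _ _ _⟩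
      _ ≤ (E ×ˢ F).card := Finset.card_image_le
      _ = E.card * F.card := Finset.card_product _ _
      _ ≤ E.card * E.card ^ t := by gcongr
      _ = _ := by rw [pow_succ, mul_comm]

open Classical in
/-- The number of `k`-sets of vertices in which `E` has a matching with `t` edges: the matching is
chosen from `E`, and the other vertices arbitrarily. -/
lemma card_containing_matched_le (E : Finset (VertexPair n)) (k t : ℕ) :
    (Finset.univ.filter fun K : Finset (Fin n) => K.card = k ∧
      ∃ S ⊆ K, S.card = 2 * t ∧ Matched (pairGraph E) S).card ≤ E.card ^ t * n ^ (k - 2 * t) := by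
  set F := Finset.univ.filter fun S : Finset (Fin n) => S.card = 2 * t ∧ Matched (pairGraph E) S
  calc _ ≤ ((F ×ˢ (Finset.univ : Finset (Fin n)).powersetCard (k - 2 * t)).image
        fun p => p.1 ∪ p.2).card := by
        refine Finset.card_le_card fun K hK => ?_
        simp only [Finset.mem_filter, Finset.mem_univ, true_and] at hK
        obtain ⟨hk, S, hSK, hS⟩ := hK
        refine Finset.mem_image.2 ⟨(S, K \ S), Finset.mem_product.2 ⟨by simpa [F] using hS, ?_⟩,
          Finset.union_sdiff_of_subset hSK⟩
        simp [Finset.mem_powersetCard, Finset.card_sdiff_of_subset hSK, hS.1, hk]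
    _ ≤ (F ×ˢ (Finset.univ : Finset (Fin n)).powersetCard (k - 2 * t)).card :=
        Finset.card_image_le
    _ = F.card * n.choose (k - 2 * t) := by simp
    _ ≤ _ := Nat.mul_le_mul (card_matched_le E t) (Nat.choose_le_pow _ _)

end Counting

/-! ### Adaptive probes and the union bound -/

section Adaptive

variable {n ℓ : ℕ}

/-- Two graphs agree on the vertex pairs in `Q`. -/
def AgreeOn (Q : Finset (VertexPair n)) (G G' : SimpleGraph (Fin n)) : Prop :=
  ∀ e ∈ Q, (G.Adj e.1.1 e.1.2 ↔ G'.Adj e.1.1 e.1.2)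

lemma AgreeOn.mono {Q Q' : Finset (VertexPair n)} {G G' : SimpleGraph (Fin n)} (hQ : Q ⊆ Q')
    (h : AgreeOn Q' G G') : AgreeOn Q G G' := fun e he => h e (hQ he)

lemma reveal_congr {E : Finset (VertexPair n)} {G G' : SimpleGraph (Fin n)}
    (h : AgreeOn E G G') : reveal G E = reveal G' E := by
  classical
  funext e
  by_cases he : e ∈ E
  · simp [reveal, he, h e he]
  · simp [reveal, he]

namespace ProbeAlgorithm

variable (A : ProbeAlgorithm n ℓ)

open Classical in
/-- The set of pairs that are probed in the first `i` rounds of the run on `G`. -/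
noncomputable def probedBefore (G : SimpleGraph (Fin n)) (i : ℕ) : Finset (VertexPair n) :=
  (Finset.univ.filter fun j : Fin ℓ => (j : ℕ) < i).biUnion (A.probesAt G)

lemma probedBefore_zero (G : SimpleGraph (Fin n)) : A.probedBefore G 0 = ∅ := by
  simp [probedBefore]

lemma probedBefore_mono (G : SimpleGraph (Fin n)) {i j : ℕ} (hij : i ≤ j) :
    A.probedBefore G i ⊆ A.probedBefore G j := by
  classical
  refine Finset.biUnion_subset_biUnion_of_subset_left _ fun x hx => ?_
  simp only [Finset.mem_filter, Finset.mem_univ, true_and] at hx ⊢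
  omega

lemma probesAt_subset (G : SimpleGraph (Fin n)) (j : Fin ℓ) {i : ℕ} (hj : (j : ℕ) < i) :
    A.probesAt G j ⊆ A.probedBefore G i := by
  classical
  exact Finset.subset_biUnion_of_mem (A.probesAt G) (by simpa using hj)

lemma card_probedBefore_le (G : SimpleGraph (Fin n)) (i : ℕ) :
    (A.probedBefore G i).card ≤ ∑ j : Fin ℓ, (A.probesAt G j).card := by
  classical
  exact Finset.card_biUnion_le.trans
    (Finset.sum_le_sum_of_subset (Finset.filter_subset _ _))

/-- The first `i` rounds of the run are determined by the pairs probed in these rounds. -/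
lemma history_congr {G G' : SimpleGraph (Fin n)} :
    ∀ (i : ℕ) (hi : i ≤ ℓ), AgreeOn (A.probedBefore G i) G G' →
      A.history G i hi = A.history G' i hi
  | 0, _, _ => rfl
  | i + 1, hi, h => by
    have ih := history_congr i (Nat.le_of_succ_le hi) (h.mono (A.probedBefore_mono G i.le_succ))
    have hr := reveal_congr (h.mono (A.probesAt_subset G ⟨i, hi⟩ i.lt_succ_self))
    simp only [history]
    rw [← ih]
    congr 1

lemma result_congr {G G' : SimpleGraph (Fin n)} (h : AgreeOn (A.probedBefore G ℓ) G G') :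
    A.result G = A.result G' := by
  rw [result, result, A.history_congr ℓ le_rfl h]

/-- The pairs probed in the first `i + 1` rounds are determined by the answers to the pairs probed
in the first `i` rounds. -/
lemma probedBefore_succ_congr {G G' : SimpleGraph (Fin n)} {i : ℕ}
    (h : AgreeOn (A.probedBefore G i) G G') :
    A.probedBefore G (i + 1) = A.probedBefore G' (i + 1) := by
  classical
  refine Finset.biUnion_congr rfl fun j hj => ?_
  simp only [Finset.mem_filter, Finset.mem_univ, true_and] at hj
  rw [probesAt, probesAt,
    A.history_congr j j.isLt.le (h.mono (A.probedBefore_mono G (by omega)))]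

lemma probedBefore_congr {G G' : SimpleGraph (Fin n)} {i : ℕ}
    (h : AgreeOn (A.probedBefore G i) G G') : A.probedBefore G i = A.probedBefore G' i := by
  cases i with
  | zero => simp [probedBefore_zero]
  | succ i => exact A.probedBefore_succ_congr (h.mono (A.probedBefore_mono G i.le_succ))

end ProbeAlgorithm

open Classical in
/-- If the event `X` and the set `Q` of revealed pairs are determined by the answers to the pairs in
`Q`, then given `X` every unrevealed pair is an edge with probability `1/2`, independently of the
others. So, if `K` has many unrevealed pairs, `K` is rarely a clique. The proof maps a graph `G` in
which `K` is a clique, together with a set `R` of unrevealed pairs of `K`, to the graph `G` without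
the edges in `R`. This map is injective. -/
lemma card_clique_mul_le (K : Finset (Fin n)) (X : Finset (SimpleGraph (Fin n)))
    (Q : SimpleGraph (Fin n) → Finset (VertexPair n))
    (hQ : ∀ G G', AgreeOn (Q G) G G' → Q G = Q G')
    (hX : ∀ G G', AgreeOn (Q G) G G' → G ∈ X → G' ∈ X) (M : ℝ)
    (hM : ∀ G ∈ X, M ≤ 2 ^ (pairsIn (Q G)ᶜ K).card) :
    ((X.filter fun G => G.IsClique (K : Set (Fin n))).card : ℝ) * M ≤ X.card := by
  set Y := X.filter fun G => G.IsClique (K : Set (Fin n)) with hY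
  let D := Y.sigma fun G => (pairsIn (Q G)ᶜ K).powerset
  have hcard : (D.card : ℝ) = ∑ G ∈ Y, (2 : ℝ) ^ (pairsIn (Q G)ᶜ K).card := by
    rw [Finset.card_sigma]; push_cast
    exact Finset.sum_congr rfl fun G _ => by rw [Finset.card_powerset]; push_cast; rfl
  have hlow : (Y.card : ℝ) * M ≤ D.card := by
    rw [hcard, ← nsmul_eq_mul]
    exact Finset.card_nsmul_le_sum _ _ _ fun G hG => hM G (Finset.mem_filter.1 hG).1
  refine hlow.trans (Nat.cast_le.2 ?_)
  have hadj : ∀ (G : SimpleGraph (Fin n)) (R : Finset (VertexPair n)) (e : VertexPair n),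
      (G \ pairGraph R).Adj e.1.1 e.1.2 ↔ G.Adj e.1.1 e.1.2 ∧ e ∉ R := by
    intro G R e
    rw [SimpleGraph.sdiff_adj, pairGraph_adj_iff]
  have hagree : ∀ p ∈ D, AgreeOn (Q p.1) p.1 (p.1 \ pairGraph p.2) := by
    rintro ⟨G, R⟩ hp e he
    simp only [D, Finset.mem_sigma, Finset.mem_powerset] at hp
    have : e ∉ R := fun h => by simpa [mem_pairsIn, he] using hp.2 h
    rw [hadj]
    tauto
  refine Finset.card_le_card_of_injOn (fun p => p.1 \ pairGraph p.2) ?_ ?_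
  · intro p hp
    have hp' : p.1 ∈ Y := (Finset.mem_sigma.1 hp).1
    exact hX _ _ (hagree p hp) (Finset.mem_filter.1 hp').1
  · rintro ⟨G, R⟩ hp ⟨G', R'⟩ hp' h
    have hQ1 := hQ _ _ (hagree _ hp)
    have hQ2 := hQ _ _ (hagree _ hp')
    simp only at h hQ1 hQ2
    simp only [D, Finset.coe_sigma, Set.mem_sigma_iff, Finset.mem_coe, Finset.mem_powerset, hY,
      Finset.mem_filter, isClique_iff_pairs] at hp hp'
    rw [h, ← hQ2] at hQ1
    rw [← hQ1] at hp'
    have key : ∀ e : VertexPair n, (G.Adj e.1.1 e.1.2 ∧ e ∉ R ↔ G'.Adj e.1.1 e.1.2 ∧ e ∉ R') := by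
      intro e
      rw [← hadj, ← hadj, h]
    have hcl : ∀ e ∈ pairsIn (Q G)ᶜ K, G.Adj e.1.1 e.1.2 ∧ G'.Adj e.1.1 e.1.2 := by
      intro e he
      have : e ∈ pairsIn .univ K := mem_pairsIn.2 ⟨Finset.mem_univ _, (mem_pairsIn.1 he).2⟩
      exact ⟨hp.1.2 e this, hp'.1.2 e this⟩
    have hR : R = R' := by
      ext e
      have h1 := @hp.2 e
      have h2 := @hp'.2 e
      have h3 := hcl e
      have h4 := key e
      tauto
    have hG : G = G' := by
      refine graph_ext_pairs fun e => ?_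
      have h2 := @hp'.2 e
      have h3 := hcl e
      have h4 := key e
      rw [hR] at h4
      tauto
    rw [hG, hR]

open Classical in
/-- The union bound over a family `F G` of at most `N` candidate sets, which is determined, with the
set `Q G` of revealed pairs, by the answers to the pairs in `Q G`. -/
lemma card_exists_clique_mul_le (F : SimpleGraph (Fin n) → Finset (Finset (Fin n)))
    (Q : SimpleGraph (Fin n) → Finset (VertexPair n))
    (hQ : ∀ G G', AgreeOn (Q G) G G' → Q G = Q G')
    (hF : ∀ G G', AgreeOn (Q G) G G' → F G = F G') (M N : ℝ) (hM0 : 0 ≤ M)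
    (hM : ∀ G, ∀ K ∈ F G, M ≤ 2 ^ (pairsIn (Q G)ᶜ K).card) (hN : ∀ G, ((F G).card : ℝ) ≤ N) :
    ((Finset.univ.filter fun G : SimpleGraph (Fin n) =>
      ∃ K ∈ F G, G.IsClique (K : Set (Fin n))).card : ℝ) * M ≤
      N * Fintype.card (SimpleGraph (Fin n)) := by
  have h1 : (Finset.univ.filter fun G : SimpleGraph (Fin n) =>
      ∃ K ∈ F G, G.IsClique (K : Set (Fin n))).card ≤
      ∑ K : Finset (Fin n), ((Finset.univ.filter fun G => K ∈ F G).filter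
        fun G => G.IsClique (K : Set (Fin n))).card := by
    refine (Finset.card_le_card fun G hG => ?_).trans Finset.card_biUnion_le
    simp only [Finset.mem_filter, Finset.mem_univ, true_and] at hG
    obtain ⟨K, hK, hG⟩ := hG
    simp only [Finset.mem_biUnion, Finset.mem_filter, Finset.mem_univ, true_and]
    exact ⟨K, hK, hG⟩
  calc _ ≤ ((∑ K : Finset (Fin n), ((Finset.univ.filter fun G => K ∈ F G).filter
        fun G => G.IsClique (K : Set (Fin n))).card : ℕ) : ℝ) * M := by gcongr
    _ = ∑ K : Finset (Fin n), (((Finset.univ.filter fun G => K ∈ F G).filter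
        fun G => G.IsClique (K : Set (Fin n))).card : ℝ) * M := by
        rw [Nat.cast_sum, Finset.sum_mul]
    _ ≤ ∑ K : Finset (Fin n), ((Finset.univ.filter fun G => K ∈ F G).card : ℝ) := by
        refine Finset.sum_le_sum fun K _ => card_clique_mul_le K _ Q hQ ?_ M ?_
        · intro G G' h hG
          simp only [Finset.mem_filter, Finset.mem_univ, true_and] at hG ⊢
          rwa [← hF G G' h]
        · intro G hG
          simp only [Finset.mem_filter, Finset.mem_univ, true_and] at hG
          exact hM G K hG
    _ = ∑ G : SimpleGraph (Fin n), ((F G).card : ℝ) := by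
        simp only [Finset.card_filter]
        push_cast
        rw [Finset.sum_comm]
        refine Finset.sum_congr rfl fun G _ => ?_
        simp
    _ ≤ ∑ G : SimpleGraph (Fin n), N := Finset.sum_le_sum fun G _ => hN G
    _ = _ := by simp [mul_comm]

end Adaptive

/-! ### Probabilities in the uniform random graph -/

/-- The random graph `G(n, 1/2)` is uniformly distributed. -/
lemma binomialRandom_half_apply {n : ℕ} (S : Set (SimpleGraph (Fin n))) :
    SimpleGraph.binomialRandom (Fin n) half S =
      ENNReal.ofReal (S.ncard / Nat.card (SimpleGraph (Fin n))) := by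
  classical
  set μ := SimpleGraph.binomialRandom (Fin n) half
  have hσ : unitInterval.toNNReal (unitInterval.symm half) = unitInterval.toNNReal half := by
    ext
    simp only [unitInterval.coe_toNNReal, unitInterval.coe_symm_eq, half]
    norm_num
  set c : ℝ≥0∞ := (unitInterval.toNNReal half : ℝ≥0∞) ^ (Nat.card (Fin n)).choose 2 with hc
  have hsingle : ∀ G : SimpleGraph (Fin n), μ {G} = c := by
    intro G
    rw [SimpleGraph.binomialRandom_singleton, hσ, ← pow_add, hc]
    congr 1
    have h1 : G.edgeSet.ncard ≤ (Nat.card (Fin n)).choose 2 := by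
      rw [Nat.card_eq_fintype_card, Set.ncard_eq_toFinset_card']
      exact G.card_edgeFinset_le_card_choose_two
    omega
  have : MeasurableSingletonClass (SimpleGraph (Fin n)) := ⟨fun G => by
    have := SimpleGraph.measurable_edgeSet (MeasurableSet.singleton G.edgeSet)
    convert this using 1
    ext G'
    simp⟩
  have happly : ∀ S : Set (SimpleGraph (Fin n)), μ S = S.ncard * c := by
    intro S
    have := MeasureTheory.sum_measure_singleton (μ := μ) (s := S.toFinset)
    rw [Set.coe_toFinset] at this
    rw [← this, Finset.sum_congr rfl fun G _ => hsingle G, Finset.sum_const, nsmul_eq_mul,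
      Set.ncard_eq_toFinset_card']
  have huniv := happly Set.univ
  rw [MeasureTheory.measure_univ, Set.ncard_univ] at huniv
  have hpos : 0 < Nat.card (SimpleGraph (Fin n)) := Nat.card_pos
  have hc' : c = (Nat.card (SimpleGraph (Fin n)) : ℝ≥0∞)⁻¹ :=
    ENNReal.eq_inv_of_mul_eq_one_left (by rw [mul_comm]; exact huniv.symm)
  rw [happly, hc', ENNReal.ofReal_div_of_pos (by exact_mod_cast hpos), ENNReal.ofReal_natCast,
    ENNReal.ofReal_natCast, div_eq_mul_inv]

/-- If every deterministic algorithm with few probes succeeds with probability less than `1/2`, then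
so does every randomized one. -/
lemma not_achievable_of_forall {δ α c : ℝ} {ℓ n : ℕ} (hc : c < 1 / 2)
    (h : ∀ A : ProbeAlgorithm n ℓ, A.ProbesAtMost ((n : ℝ) ^ δ) →
      ((A.successSet (α * Real.logb 2 n)).ncard : ℝ) ≤ c * Nat.card (SimpleGraph (Fin n))) :
    ¬ Achievable δ ℓ α n := by
  rintro ⟨P, hP, hhalf⟩
  have hpos : (0 : ℝ) < Nat.card (SimpleGraph (Fin n)) := by exact_mod_cast Nat.card_pos
  have hle : successProb P (α * Real.logb 2 n) ≤ ENNReal.ofReal c := by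
    calc successProb P (α * Real.logb 2 n) ≤ ∑' A, P A * ENNReal.ofReal c := by
          refine ENNReal.tsum_le_tsum fun A => ?_
          by_cases hA : P A = 0
          · simp [hA]
          · gcongr
            rw [binomialRandom_half_apply]
            refine ENNReal.ofReal_le_ofReal ?_
            rw [div_le_iff₀ hpos]
            exact h A (hP A ((PMF.mem_support_iff _ _).2 hA))
      _ = ENNReal.ofReal c := by rw [ENNReal.tsum_mul_right, P.tsum_coe, one_mul]
  have : ENNReal.ofReal c < 1 / 2 := by
    rw [show (1 / 2 : ℝ≥0∞) = ENNReal.ofReal (1 / 2) by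
      rw [ENNReal.ofReal_div_of_pos (by norm_num)]; simp]
    exact (ENNReal.ofReal_lt_ofReal_iff (by norm_num)).2 hc
  exact absurd (hhalf.trans hle) this.not_ge

/-! ### The function `f` -/

/-- `f B δ` is `1 - (2 - δ) * x₀`, where `x₀` is the smaller solution of `4 * x ^ 2 = B` and
`2 * x - x ^ 2 = B`. Slightly to the left of `x₀`, both left-hand sides are less than `B`. -/
lemma exists_fraction_of_f_lt {δ B c : ℝ} (hδ : δ < 2) (hB0 : 0 ≤ B) (hB1 : B ≤ 1)
    (hc : f B δ < c) : ∃ x : ℝ, 1 - (2 - δ) * x < c ∧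
      (x ≤ 0 ∨ (0 < x ∧ x ≤ 1 ∧ 4 * x ^ 2 < B ∧ 2 * x - x ^ 2 < B)) := by
  obtain ⟨x₀, hx₀, hf, h1, h2⟩ : ∃ x₀ : ℝ, x₀ ≤ 1 ∧ f B δ = 1 - (2 - δ) * x₀ ∧
      (0 ≤ x₀ → 4 * x₀ ^ 2 ≤ B) ∧ (0 ≤ x₀ → 2 * x₀ - x₀ ^ 2 ≤ B) := by
    by_cases hB : B ≤ 16 / 25
    · have hs := Real.sqrt_nonneg (1 - B)
      have hs2 := Real.sq_sqrt (by linarith : 0 ≤ 1 - B)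
      have hs3 : 3 / 5 ≤ √(1 - B) := Real.le_sqrt_of_sq_le (by linarith)
      refine ⟨1 - √(1 - B), by linarith, by rw [f, if_pos hB]; ring, fun h => ?_, fun h => ?_⟩ <;>
        nlinarith
    · have hs := Real.sqrt_nonneg B
      have hs2 := Real.sq_sqrt hB0
      have hs3 : 4 / 5 ≤ √B := Real.le_sqrt_of_sq_le (by linarith)
      have hs4 : √B ≤ 1 := Real.sqrt_le_one.2 hB1
      refine ⟨√B / 2, by linarith, by rw [f, if_neg hB]; ring, fun h => ?_, fun h => ?_⟩ <;>
        nlinarith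
  rw [hf] at hc
  have hη : 0 < (c - (1 - (2 - δ) * x₀)) / (2 - δ) := div_pos (by linarith) (by linarith)
  set η := (c - (1 - (2 - δ) * x₀)) / (2 - δ) with hηdef
  have hmul : (2 - δ) * η = c - (1 - (2 - δ) * x₀) := by
    rw [hηdef]; field_simp [(by linarith : (2 : ℝ) - δ ≠ 0)]
  refine ⟨x₀ - η / 2, by nlinarith, ?_⟩
  by_cases hx : x₀ - η / 2 ≤ 0
  · exact .inl hx
  · push Not at hx
    have h1 := h1 (by linarith)
    have h2 := h2 (by linarith)
    exact .inr ⟨hx, by linarith, by nlinarith, by nlinarith⟩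

lemma continuous_f (δ : ℝ) : Continuous fun β => f β δ := by
  unfold f
  refine Continuous.if_le (by fun_prop) (by fun_prop) continuous_id continuous_const ?_
  rintro x rfl
  have h1 : √(1 - 16 / 25 : ℝ) = 3 / 5 := by
    rw [show (1 - 16 / 25 : ℝ) = (3 / 5) ^ 2 by norm_num, Real.sqrt_sq (by norm_num)]
  have h2 : √(16 / 25 : ℝ) = 4 / 5 := by
    rw [show (16 / 25 : ℝ) = (4 / 5) ^ 2 by norm_num, Real.sqrt_sq (by norm_num)]
  rw [h1, h2]; ring

lemma f_pos {δ β : ℝ} (hδ₁ : 1 ≤ δ) (hδ₂ : δ < 2) (hβ : β ≤ 1) : 0 < f β δ := by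
  rw [f]
  split_ifs with h
  · have : 3 / 5 ≤ √(1 - β) := Real.le_sqrt_of_sq_le (by linarith)
    nlinarith
  · have : √β ≤ 1 := Real.sqrt_le_one.2 hβ
    nlinarith

lemma f_le_linear {δ β : ℝ} (hδ₂ : δ < 2) (hβ0 : 0 ≤ β) (hβ1 : β ≤ 1) :
    f β δ ≤ 1 - (1 - δ / 2) * β := by
  rw [f]
  split_ifs with h
  · have : √(1 - β) ≤ 1 - β / 2 := Real.sqrt_le_iff.2 ⟨by linarith, by nlinarith⟩
    nlinarith
  · have : β ≤ √β := Real.le_sqrt_of_sq_le (by nlinarith)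
    nlinarith

/-! ### The number of dense vertex sets -/

open Filter in
/-- The Erdős–Gallai bound for large sets: a graph on `k` vertices with at least the proportion
`B > max (4 * x ^ 2) (2 * x - x ^ 2)` of the pairs has a matching with at least `x * k` edges. -/
lemma eventually_exists_matched_of_dense {x B : ℝ}
    (hx : x ≤ 0 ∨ (0 < x ∧ x ≤ 1 ∧ 4 * x ^ 2 < B ∧ 2 * x - x ^ 2 < B)) :
    ∀ᶠ k : ℕ in atTop, ∀ (n : ℕ) (E : Finset (VertexPair n)) (K : Finset (Fin n)), K.card = k →
      B * (k * (k - 1) / 2) ≤ (pairsIn E K).card →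
      ∃ S ⊆ K, S.card = 2 * ⌈x * k⌉₊ ∧ Matched (pairGraph E) S := by
  classical
  rcases hx with hx | ⟨hx0, hx1, hB1, hB2⟩
  · refine Eventually.of_forall fun k n E K _ _ => ⟨∅, by simp, ?_, .empty⟩
    rw [Nat.ceil_eq_zero.2 (mul_nonpos_of_nonpos_of_nonneg hx (Nat.cast_nonneg k))]
    simp
  · set D := max (4 * x ^ 2) (2 * x - x ^ 2) with hD
    have hDB : D < B := max_lt hB1 hB2
    filter_upwards [tendsto_natCast_atTop_atTop.eventually_gt_atTop ((B + 2 * x) / (B - D))]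
      with k hk n E K hK hdense
    rw [div_lt_iff₀ (by linarith)] at hk
    by_contra hcon
    push Not at hcon
    obtain ⟨ν, hν⟩ : ∃ ν, ⌈x * k⌉₊ = ν + 1 := by
      refine Nat.exists_eq_succ_of_ne_zero fun h0 => ?_
      rw [h0] at hcon
      exact hcon ∅ (by simp) (by simp) .empty
    rw [hν] at hcon
    have hνx : (ν : ℝ) < x * k := Nat.lt_ceil.1 (by omega)
    have hEG := sum_degree_le_of_no_matching hcon
    have hlow : 2 * ((pairsIn E K).card : ℝ) ≤
        (∑ u ∈ K, (K.filter ((pairGraph E).Adj u)).card : ℕ) := by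
      exact_mod_cast two_mul_card_pairsIn_le E K
    rw [hK] at hEG
    have hk0 : (0 : ℝ) ≤ k := Nat.cast_nonneg k
    have hν0 : (0 : ℝ) ≤ ν := Nat.cast_nonneg ν
    have hmax : max (4 * (ν : ℝ) ^ 2) (2 * k * ν - (ν : ℝ) ^ 2) ≤ D * k ^ 2 := by
      refine max_le ?_ ?_
      · have := mul_le_mul_of_nonneg_right (le_max_left (4 * x ^ 2) (2 * x - x ^ 2))
          (sq_nonneg (k : ℝ))
        nlinarith
      · have := mul_le_mul_of_nonneg_right (le_max_right (4 * x ^ 2) (2 * x - x ^ 2))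
          (sq_nonneg (k : ℝ))
        have h2 : 0 ≤ (x * k - ν) * (2 * k - x * k - ν) :=
          mul_nonneg (by linarith) (by nlinarith)
        nlinarith
    have hkpos : (0 : ℝ) < k := by
      by_contra h
      have : (k : ℝ) = 0 := le_antisymm (not_lt.1 h) hk0
      rw [this] at hνx; linarith
    have : (B - D) * k * k ≤ (B + 2 * x) * k := by nlinarith
    have := le_of_mul_le_mul_right this hkpos
    linarith

open Classical in
/-- If every dense `k`-set has a matching with at least `x * k` edges, then there are at most
`n ^ (k * (1 - (2 - δ) * x))` dense `k`-sets with respect to `n ^ δ` pairs. -/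
lemma card_dense_le {n k : ℕ} {x δ b : ℝ} (hn : 1 ≤ n) (hδ : δ < 2) (E : Finset (VertexPair n))
    (hE : (E.card : ℝ) ≤ (n : ℝ) ^ δ)
    (h : ∀ K : Finset (Fin n), K.card = k → b ≤ (pairsIn E K).card →
      ∃ S ⊆ K, S.card = 2 * ⌈x * k⌉₊ ∧ Matched (pairGraph E) S) :
    ((Finset.univ.filter fun K : Finset (Fin n) =>
      K.card = k ∧ b ≤ (pairsIn E K).card).card : ℝ) ≤ (n : ℝ) ^ (k * (1 - (2 - δ) * x)) := by
  set t := ⌈x * k⌉₊ with ht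
  have hn' : (1 : ℝ) ≤ n := by exact_mod_cast hn
  have hn0 : (0 : ℝ) < n := by linarith
  by_cases htk : 2 * t ≤ k
  · have h1 : (Finset.univ.filter fun K : Finset (Fin n) =>
        K.card = k ∧ b ≤ (pairsIn E K).card).card ≤ E.card ^ t * n ^ (k - 2 * t) := by
      refine (Finset.card_le_card fun K hK => ?_).trans (card_containing_matched_le E k t)
      simp only [Finset.mem_filter, Finset.mem_univ, true_and] at hK ⊢
      exact ⟨hK.1, h K hK.1 hK.2⟩
    calc _ ≤ ((E.card ^ t * n ^ (k - 2 * t) : ℕ) : ℝ) := Nat.cast_le.2 h1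
      _ = (E.card : ℝ) ^ t * (n : ℝ) ^ (k - 2 * t) := by push_cast; rfl
      _ ≤ ((n : ℝ) ^ δ) ^ t * (n : ℝ) ^ (k - 2 * t) := by gcongr
      _ = (n : ℝ) ^ (δ * t + (k - 2 * t)) := by
          rw [Real.rpow_add hn0, Real.rpow_mul hn0.le, Real.rpow_natCast, ← Real.rpow_natCast,
            ← Real.rpow_natCast (n : ℝ), Nat.cast_sub htk]
          push_cast; rfl
      _ ≤ _ := by
          refine Real.rpow_le_rpow_of_exponent_le hn' ?_
          have := Nat.le_ceil (x * k)
          nlinarith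
  · have h1 : (Finset.univ.filter fun K : Finset (Fin n) =>
        K.card = k ∧ b ≤ (pairsIn E K).card) = ∅ := by
      refine Finset.filter_eq_empty_iff.2 fun K _ ⟨hK, hb⟩ => ?_
      obtain ⟨S, hSK, hS, -⟩ := h K hK hb
      have := Finset.card_le_card hSK
      omega
    rw [h1]
    simpa using Real.rpow_nonneg hn0.le _

/-! ### The success probability of a deterministic algorithm -/

section Success

variable {n ℓ : ℕ}

lemma card_pairsIn_add_compl (Q : Finset (VertexPair n)) (K : Finset (Fin n)) :
    ((pairsIn Q K).card : ℝ) + (pairsIn Qᶜ K).card = K.card * (K.card - 1) / 2 := by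
  have h1 : (pairsIn Q K).card + (pairsIn Qᶜ K).card = (pairsIn .univ K).card := by
    rw [← Finset.card_union_of_disjoint]
    · congr 1
      ext e
      simp only [Finset.mem_union, mem_pairsIn, Finset.mem_compl, Finset.mem_univ]
      tauto
    · rw [Finset.disjoint_left]
      intro e h h'
      rw [mem_pairsIn] at h h'
      exact Finset.mem_compl.1 h'.1 h.1
  have h2 := two_mul_card_pairsIn_univ K
  have h3 : (2 : ℝ) * (pairsIn .univ K).card = K.card * (K.card - 1) := by
    rcases Nat.eq_zero_or_pos K.card with h | h
    · rw [h] at h2 ⊢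
      simpa using h2
    · have h4 := congrArg (Nat.cast : ℕ → ℝ) h2
      rw [Nat.cast_mul, Nat.cast_mul, Nat.cast_sub h] at h4
      exact_mod_cast h4
  rw [← h1] at h3
  push_cast at h3
  linarith

open Classical in
/-- The union bound for a deterministic algorithm. Suppose that it finds a clique with `k` vertices.
Either a proportion of at least `ε` of the pairs of the clique is never probed, or there is a first
round `i` such that at least the proportion `B (i + 1) - ε` of these pairs is probed by the end of
the round. At the start of that round, a proportion of at least `1 - B i` of the pairs was not
yet probed. -/
lemma ncard_successSet_le (A : ProbeAlgorithm n ℓ) {T s ε : ℝ} (hA : A.ProbesAtMost T)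
    (hℓ : 1 ≤ ℓ) (B N : ℕ → ℝ) (hB0 : B 0 = 0) (hBℓ : B ℓ = 1)
    (hN : ∀ i < ℓ, ∀ E : Finset (VertexPair n), (E.card : ℝ) ≤ T →
      ((Finset.univ.filter fun K : Finset (Fin n) => K.card = ⌈s⌉₊ ∧
        (B (i + 1) - ε) * (⌈s⌉₊ * (⌈s⌉₊ - 1) / 2) ≤ (pairsIn E K).card).card : ℝ) ≤ N i) :
    ((A.successSet s).ncard : ℝ) ≤
      ((∑ i ∈ Finset.range ℓ, N i * 2 ^ (-((1 - B i) * (⌈s⌉₊ * (⌈s⌉₊ - 1) / 2) : ℝ))) +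
        2 ^ (-(ε * (⌈s⌉₊ * (⌈s⌉₊ - 1) / 2) : ℝ))) * Nat.card (SimpleGraph (Fin n)) := by
  set k := ⌈s⌉₊ with hk
  set w : ℝ := k * (k - 1) / 2 with hw
  have hw0 : 0 ≤ w := by
    rcases Nat.eq_zero_or_pos k with h | h
    · simp [hw, h]
    · have : (1 : ℝ) ≤ k := by exact_mod_cast h
      rw [hw]; nlinarith
  have hT : ∀ G i, ((A.probedBefore G i).card : ℝ) ≤ T := fun G i =>
    (Nat.cast_le.2 (A.card_probedBefore_le G i)).trans (hA G)
  -- the candidate cliques of round `i`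
  let F : ℕ → SimpleGraph (Fin n) → Finset (Finset (Fin n)) := fun i G =>
    Finset.univ.filter fun K => (K.card = k ∧
      (B (i + 1) - ε) * w ≤ (pairsIn (A.probedBefore G (i + 1)) K).card) ∧
      (1 - B i) * w ≤ (pairsIn (A.probedBefore G i)ᶜ K).card
  have hround : ∀ i < ℓ, ((Finset.univ.filter fun G : SimpleGraph (Fin n) =>
      ∃ K ∈ F i G, G.IsClique (K : Set (Fin n))).card : ℝ) ≤
      N i * 2 ^ (-((1 - B i) * w)) * Nat.card (SimpleGraph (Fin n)) := by
    intro i hi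
    have h := card_exists_clique_mul_le (F i) (fun G => A.probedBefore G i)
      (fun G G' h => A.probedBefore_congr h)
      (fun G G' h => by
        simp only [F, A.probedBefore_succ_congr h, A.probedBefore_congr h])
      (2 ^ ((1 - B i) * w)) (N i) (by positivity)
      (fun G K hK => by
        simp only [F, Finset.mem_filter] at hK
        rw [← Real.rpow_natCast]
        exact Real.rpow_le_rpow_of_exponent_le (by norm_num) hK.2.2)
      (fun G => by
        refine le_trans (Nat.cast_le.2 (Finset.card_le_card fun K hK => ?_))
          (hN i hi _ (hT G (i + 1)))
        simp only [F, Finset.mem_filter] at hK ⊢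
        exact ⟨hK.1, hK.2.1⟩)
    rw [Real.rpow_neg (by norm_num), ← Fintype.card_eq_nat_card, mul_right_comm, ← div_eq_mul_inv,
      le_div_iff₀ (by positivity)]
    exact h
  -- a `k`-subset of the output, chosen as a function of the output
  have hsub : ∀ R : Finset (Fin n), ∃ K : Finset (Fin n), k ≤ R.card → K ⊆ R ∧ K.card = k := by
    intro R
    by_cases h : k ≤ R.card
    · obtain ⟨K, hK⟩ := Finset.exists_subset_card_eq h
      exact ⟨K, fun _ => hK⟩
    · exact ⟨∅, fun h' => absurd h' h⟩
  choose sub hsub using hsub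
  let F' : SimpleGraph (Fin n) → Finset (Finset (Fin n)) := fun G =>
    if ε * w ≤ (pairsIn (A.probedBefore G ℓ)ᶜ (sub (A.result G))).card then {sub (A.result G)}
    else ∅
  have hlast : ((Finset.univ.filter fun G : SimpleGraph (Fin n) =>
      ∃ K ∈ F' G, G.IsClique (K : Set (Fin n))).card : ℝ) ≤
      2 ^ (-(ε * w)) * Nat.card (SimpleGraph (Fin n)) := by
    have h := card_exists_clique_mul_le F' (fun G => A.probedBefore G ℓ)
      (fun G G' h => A.probedBefore_congr h)
      (fun G G' h => by
        simp only [F', A.result_congr h, A.probedBefore_congr h])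
      (2 ^ (ε * w)) 1 (by positivity)
      (fun G K hK => by
        rw [← Real.rpow_natCast]
        refine Real.rpow_le_rpow_of_exponent_le (by norm_num) ?_
        simp only [F'] at hK
        split_ifs at hK with hc
        · rw [Finset.mem_singleton.1 hK]; exact hc
        · simp at hK)
      (fun G => by
        simp only [F']
        split_ifs <;> simp)
    rw [Real.rpow_neg (by norm_num), ← Fintype.card_eq_nat_card, mul_comm, ← div_eq_mul_inv,
      le_div_iff₀ (by positivity)]
    simpa using h
  have hcover : A.successSet s ⊆
      (((Finset.range ℓ).biUnion fun i => Finset.univ.filter fun G : SimpleGraph (Fin n) =>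
        ∃ K ∈ F i G, G.IsClique (K : Set (Fin n))) ∪
      Finset.univ.filter fun G : SimpleGraph (Fin n) =>
        ∃ K ∈ F' G, G.IsClique (K : Set (Fin n)) : Finset (SimpleGraph (Fin n))) := by
    rintro G ⟨hcl, hs⟩
    obtain ⟨hKR, hKk⟩ := hsub (A.result G) (Nat.ceil_le.2 hs)
    set K := sub (A.result G) with hK
    have hclK : G.IsClique (K : Set (Fin n)) := hcl.subset hKR
    have hsplit : ∀ i, ((pairsIn (A.probedBefore G i) K).card : ℝ) +
        (pairsIn (A.probedBefore G i)ᶜ K).card = w := by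
      intro i
      rw [card_pairsIn_add_compl, hKk]
    simp only [Finset.coe_union, Set.mem_union, Finset.mem_coe, Finset.mem_biUnion,
      Finset.mem_range, Finset.mem_filter, Finset.mem_univ, true_and]
    by_cases hfresh : ε * w ≤ (pairsIn (A.probedBefore G ℓ)ᶜ K).card
    · exact .inr ⟨K, by simp only [F', ← hK, if_pos hfresh, Finset.mem_singleton], hclK⟩
    left
    let P : ℕ → Prop := fun i =>
      (B (i + 1) - ε) * w ≤ (pairsIn (A.probedBefore G (i + 1)) K).card
    have hP : P (ℓ - 1) := by
      have := hsplit ℓ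
      simp only [P, Nat.sub_add_cancel hℓ, hBℓ]
      linarith
    have hex : ∃ i, P i := ⟨_, hP⟩
    refine ⟨Nat.find hex, ?_, K, ?_, hclK⟩
    · have := Nat.find_min' hex hP
      omega
    · simp only [F, Finset.mem_filter, Finset.mem_univ, true_and]
      refine ⟨⟨hKk, Nat.find_spec hex⟩, ?_⟩
      have hspl := hsplit (Nat.find hex)
      rcases Nat.eq_zero_or_pos (Nat.find hex) with h0 | h0
      · rw [h0, A.probedBefore_zero] at hspl
        rw [h0, A.probedBefore_zero, hB0]
        simp only [pairsIn, Finset.filter_empty, Finset.card_empty, Nat.cast_zero] at hspl ⊢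
        linarith
      · have hmin : ¬ P (Nat.find hex - 1) := Nat.find_min hex (by omega)
        simp only [P, Nat.sub_add_cancel h0, not_le] at hmin
        have : 0 ≤ ε * w := (Nat.cast_nonneg _).trans (not_le.1 hfresh).le
        linarith
  calc ((A.successSet s).ncard : ℝ) ≤ _ := Nat.cast_le.2
        ((Set.ncard_le_ncard hcover (Set.toFinite _)).trans_eq (Set.ncard_coe_finset _))
    _ ≤ (((∑ i ∈ Finset.range ℓ, (Finset.univ.filter fun G : SimpleGraph (Fin n) =>
          ∃ K ∈ F i G, G.IsClique (K : Set (Fin n))).card) +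
        (Finset.univ.filter fun G : SimpleGraph (Fin n) =>
          ∃ K ∈ F' G, G.IsClique (K : Set (Fin n))).card : ℕ) : ℝ) :=
        Nat.cast_le.2 ((Finset.card_union_le _ _).trans
          (Nat.add_le_add_right Finset.card_biUnion_le _))
    _ ≤ _ := by
        push_cast
        rw [add_mul, Finset.sum_mul]
        exact add_le_add (Finset.sum_le_sum fun i hi => hround i (Finset.mem_range.1 hi)) hlast

end Success

/-! ### The upper bound on `α⋆` -/

open Filter Topology

/-- The exponent of the union bound: with `L = logb 2 n`, the left-hand side bounds the expected
number of cliques among `n ^ (k * e)` sets of `k ≥ α * L` vertices, in each of which the proportion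
`1 - b` of the pairs is unprobed. It is small if `e < α * (1 - b) / 2` and `L` is large. -/
lemma two_rpow_mul_le {L k e α b : ℝ} (hb : 0 ≤ b) (hb1 : b ≤ 1) (hk1 : 1 ≤ k) (hk : α * L ≤ k)
    (hL : 1 / 2 ≤ (α * (1 - b) / 2 - e) * L) :
    (2 : ℝ) ^ (L * (k * e)) * 2 ^ (-((1 - b) * (k * (k - 1) / 2))) ≤
      2 ^ (1 / 2 - (α * (1 - b) / 2 - e) * L) := by
  rw [← Real.rpow_add (by norm_num)]
  refine Real.rpow_le_rpow_of_exponent_le (by norm_num) ?_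
  have h1 : L * e - (1 - b) * (k - 1) / 2 ≤ 1 / 2 - (α * (1 - b) / 2 - e) * L := by
    nlinarith [mul_nonneg (by linarith : 0 ≤ 1 - b) (by linarith : 0 ≤ k - α * L)]
  nlinarith

open Classical in
/-- If `2 * f (B (i + 1)) < α * (1 - B i)` for all `i`, then `α` is not achievable for large `n`. -/
theorem eventually_not_achievable {δ α : ℝ} {ℓ : ℕ} (hδ : δ < 2) (hℓ : 1 ≤ ℓ) (hα : 0 < α)
    (B : ℕ → ℝ) (hB0 : B 0 = 0) (hBℓ : B ℓ = 1) (hBnn : ∀ i, 0 ≤ B i) (hB1 : ∀ i, B i ≤ 1)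
    (hf : ∀ i < ℓ, 2 * f (B (i + 1)) δ < α * (1 - B i)) :
    ∀ᶠ n : ℕ in atTop, ¬ Achievable δ ℓ α n := by
  have hx : ∀ i, ∃ x : ℝ, i < ℓ → 1 - (2 - δ) * x < α * (1 - B i) / 2 ∧
      (x ≤ 0 ∨ (0 < x ∧ x ≤ 1 ∧ 4 * x ^ 2 < B (i + 1) ∧ 2 * x - x ^ 2 < B (i + 1))) := by
    intro i
    by_cases hi : i < ℓ
    · obtain ⟨x, hx⟩ := exists_fraction_of_f_lt hδ (hBnn (i + 1)) (hB1 (i + 1))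
        (show f (B (i + 1)) δ < α * (1 - B i) / 2 by linarith [hf i hi])
      exact ⟨x, fun _ => hx⟩
    · exact ⟨0, fun h => absurd h hi⟩
  choose x hx using hx
  obtain ⟨ε, hε, hεx⟩ : ∃ ε : ℝ, 0 < ε ∧ ∀ i ∈ Finset.range ℓ, (x i ≤ 0 ∨ (0 < x i ∧ x i ≤ 1 ∧
      4 * x i ^ 2 < B (i + 1) - ε ∧ 2 * x i - x i ^ 2 < B (i + 1) - ε)) := by
    have : ∀ᶠ ε : ℝ in 𝓝[>] 0, ∀ i ∈ Finset.range ℓ, (x i ≤ 0 ∨ (0 < x i ∧ x i ≤ 1 ∧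
        4 * x i ^ 2 < B (i + 1) - ε ∧ 2 * x i - x i ^ 2 < B (i + 1) - ε)) := by
      rw [Filter.eventually_all_finset]
      intro i hi
      have ht : Tendsto (fun ε : ℝ => B (i + 1) - ε) (𝓝[>] 0) (𝓝 (B (i + 1))) := by
        have : Tendsto (fun ε : ℝ => B (i + 1) - ε) (𝓝 0) (𝓝 (B (i + 1) - 0)) :=
          tendsto_const_nhds.sub tendsto_id
        rw [sub_zero] at this
        exact this.mono_left nhdsWithin_le_nhds
      rcases (hx i (Finset.mem_range.1 hi)).2 with h | ⟨h0, h1, h2, h3⟩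
      · exact .of_forall fun _ => .inl h
      · filter_upwards [ht.eventually_const_lt h2, ht.eventually_const_lt h3] with ε h4 h5
        exact .inr ⟨h0, h1, h4, h5⟩
    obtain ⟨ε, h1, h2⟩ := (this.and self_mem_nhdsWithin).exists
    exact ⟨ε, h2, h1⟩
  -- each of the `ℓ + 1` terms of the union bound is at most `τ`
  set τ : ℝ := 1 / (4 * (ℓ + 1)) with hτ
  have hτ0 : 0 < τ := by positivity
  set L : ℕ → ℝ := fun n => Real.logb 2 n with hL
  have hLtop : Tendsto L atTop atTop :=
    (Real.tendsto_logb_atTop (by norm_num)).comp tendsto_natCast_atTop_atTop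
  have hktop : Tendsto (fun n => ⌈α * L n⌉₊) atTop atTop :=
    tendsto_nat_ceil_atTop.comp (hLtop.const_mul_atTop hα)
  have h2top : ∀ {g : ℕ → ℝ}, Tendsto g atTop atBot → ∀ᶠ n in atTop, (2 : ℝ) ^ g n ≤ τ := by
    intro g hg
    exact ((tendsto_rpow_atBot_of_base_gt_one 2 (by norm_num)).comp hg).eventually_le_const hτ0
  have hrounds : ∀ᶠ n in atTop, ∀ i ∈ Finset.range ℓ,
      (∀ E : Finset (VertexPair n), (E.card : ℝ) ≤ (n : ℝ) ^ δ →
        ((Finset.univ.filter fun K : Finset (Fin n) => K.card = ⌈α * L n⌉₊ ∧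
          (B (i + 1) - ε) * (⌈α * L n⌉₊ * (⌈α * L n⌉₊ - 1) / 2) ≤ (pairsIn E K).card).card : ℝ) ≤
          (n : ℝ) ^ (⌈α * L n⌉₊ * (1 - (2 - δ) * x i))) ∧
      (n : ℝ) ^ (⌈α * L n⌉₊ * (1 - (2 - δ) * x i)) *
        2 ^ (-((1 - B i) * (⌈α * L n⌉₊ * (⌈α * L n⌉₊ - 1) / 2) : ℝ)) ≤ τ := by
    rw [Filter.eventually_all_finset]
    intro i hi
    have hη : 0 < α * (1 - B i) / 2 - (1 - (2 - δ) * x i) := by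
      linarith [(hx i (Finset.mem_range.1 hi)).1]
    have hηL := hLtop.const_mul_atTop hη
    have hbot : Tendsto (fun n => 1 / 2 - (α * (1 - B i) / 2 - (1 - (2 - δ) * x i)) * L n)
        atTop atBot := by
      have := tendsto_atBot_add_const_left atTop (1 / 2 : ℝ) (tendsto_neg_atTop_atBot.comp hηL)
      exact this.congr fun n => (sub_eq_add_neg _ _).symm
    filter_upwards [hktop.eventually (eventually_exists_matched_of_dense (hεx i hi)),
      hηL.eventually_ge_atTop (1 / 2), h2top hbot, hktop.eventually_ge_atTop 1,
      eventually_ge_atTop 1] with n h1 h2 h3 h4 h5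
    refine ⟨fun E hE => card_dense_le h5 hδ E hE (h1 n E), ?_⟩
    have hn : (n : ℝ) = 2 ^ L n :=
      (Real.rpow_logb (by norm_num) (by norm_num) (by exact_mod_cast h5)).symm
    refine le_trans ?_ h3
    nth_rewrite 1 [hn]
    rw [← Real.rpow_mul (by norm_num)]
    exact two_rpow_mul_le (hBnn i) (hB1 i) (by exact_mod_cast h4) (Nat.le_ceil _) h2
  have hlast : ∀ᶠ n in atTop, (2 : ℝ) ^ (-(ε * (⌈α * L n⌉₊ * (⌈α * L n⌉₊ - 1) / 2) : ℝ)) ≤ τ := by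
    refine h2top ?_
    have hk : Tendsto (fun n => (⌈α * L n⌉₊ : ℝ)) atTop atTop :=
      tendsto_natCast_atTop_atTop.comp hktop
    have h1 : Tendsto (fun n => (⌈α * L n⌉₊ : ℝ) * (⌈α * L n⌉₊ - 1) / 2) atTop atTop :=
      (hk.atTop_mul_atTop₀ (tendsto_atTop_add_const_right _ (-1) hk)).atTop_div_const (by norm_num)
    exact tendsto_neg_atTop_atBot.comp (h1.const_mul_atTop hε)
  filter_upwards [hrounds, hlast] with n h1 h2
  refine not_achievable_of_forall (c := 1 / 4) (by norm_num) fun A hA => ?_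
  refine (ncard_successSet_le A hA hℓ B
    (fun i => (n : ℝ) ^ (⌈α * L n⌉₊ * (1 - (2 - δ) * x i))) hB0 hBℓ
    fun i hi E hE => (h1 i (Finset.mem_range.2 hi)).1 E hE).trans ?_
  refine mul_le_mul_of_nonneg_right ?_ (Nat.cast_nonneg _)
  have hsum := Finset.sum_le_sum fun i hi => (h1 i hi).2
  rw [Finset.sum_const, Finset.card_range, nsmul_eq_mul] at hsum
  refine (add_le_add hsum h2).trans_eq ?_
  rw [hτ]; field_simp

/-- The partial sum `β₁ + ⋯ + βᵢ`. -/
noncomputable def partialSum {ℓ : ℕ} (β : Fin ℓ → ℝ) (i : ℕ) : ℝ :=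
  ∑ j ∈ Finset.univ.filter fun j : Fin ℓ => (j : ℕ) < i, β j

section PartialSum

variable {ℓ : ℕ} {β : Fin ℓ → ℝ}

lemma sum_Iic_eq_partialSum (β : Fin ℓ → ℝ) (i : Fin ℓ) :
    ∑ j ∈ Finset.Iic i, β j = partialSum β (i + 1) := by
  refine Finset.sum_congr ?_ fun _ _ => rfl
  ext j
  simp only [Finset.mem_Iic, Finset.mem_filter, Finset.mem_univ, true_and, Fin.le_def]
  omega

lemma sum_Ici_eq_one_sub_partialSum (hβ : β ∈ stdSimplex ℝ (Fin ℓ)) (i : Fin ℓ) :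
    ∑ j ∈ Finset.Ici i, β j = 1 - partialSum β i := by
  rw [← hβ.2, partialSum, ← Finset.sum_filter_add_sum_filter_not Finset.univ
    (fun j : Fin ℓ => (j : ℕ) < i) β, add_sub_cancel_left]
  refine Finset.sum_congr ?_ fun _ _ => rfl
  ext j
  simp only [Finset.mem_Ici, Finset.mem_filter, Finset.mem_univ, true_and, Fin.le_def, not_lt]

lemma partialSum_nonneg (hβ : β ∈ stdSimplex ℝ (Fin ℓ)) (i : ℕ) : 0 ≤ partialSum β i :=
  Finset.sum_nonneg fun j _ => hβ.1 j

lemma partialSum_le_one (hβ : β ∈ stdSimplex ℝ (Fin ℓ)) (i : ℕ) : partialSum β i ≤ 1 := by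
  rw [← hβ.2]
  exact Finset.sum_le_sum_of_subset_of_nonneg (Finset.filter_subset _ _) fun j _ _ => hβ.1 j

lemma cliqueBound_eq (δ : ℝ) (hβ : β ∈ stdSimplex ℝ (Fin ℓ)) :
    cliqueBound δ β = ⨆ i : Fin ℓ, ENNReal.ofReal (2 * f (partialSum β (i + 1)) δ) /
      ENNReal.ofReal (1 - partialSum β i) := by
  simp_rw [cliqueBound, sum_Iic_eq_partialSum, sum_Ici_eq_one_sub_partialSum hβ]

end PartialSum

/-- Each point of the simplex gives an upper bound on `α⋆`. -/
theorem alphaStar_le_cliqueBound {δ : ℝ} (hδ₁ : 1 ≤ δ) (hδ₂ : δ < 2) {ℓ : ℕ} (hℓ : 1 ≤ ℓ)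
    {β : Fin ℓ → ℝ} (hβ : β ∈ stdSimplex ℝ (Fin ℓ)) :
    alphaStar δ ℓ ≤ (cliqueBound δ β : EReal) := by
  refine iSup₂_le fun α hα => ?_
  by_contra hlt
  rw [not_le] at hlt
  have hα0 : 0 < α := by
    have : ((0 : ℝ) : EReal) < α := (EReal.coe_ennreal_nonneg _).trans_lt hlt
    exact_mod_cast this
  have hlt' : cliqueBound δ β < ENNReal.ofReal α := by
    rw [← EReal.coe_ennreal_lt_coe_ennreal_iff, EReal.coe_ennreal_ofReal, max_eq_left hα0.le]
    exact hlt
  refine hα (eventually_not_achievable hδ₂ hℓ hα0 (partialSum β) (by simp [partialSum]) ?_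
    (partialSum_nonneg hβ) (partialSum_le_one hβ) fun i hi => ?_)
  · rw [← hβ.2, partialSum]
    congr 1
    ext j
    simp
  · have h1 : ENNReal.ofReal (2 * f (partialSum β (i + 1)) δ) /
        ENNReal.ofReal (1 - partialSum β i) < ENNReal.ofReal α := by
      refine lt_of_le_of_lt ?_ hlt'
      rw [cliqueBound_eq δ hβ]
      exact le_iSup (fun i : Fin ℓ => ENNReal.ofReal (2 * f (partialSum β (i + 1)) δ) /
        ENNReal.ofReal (1 - partialSum β i)) ⟨i, hi⟩
    have hfpos := f_pos hδ₁ hδ₂ (partialSum_le_one hβ (i + 1))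
    have hden : 0 < 1 - partialSum β i := by
      by_contra hden
      rw [ENNReal.ofReal_of_nonpos (not_lt.1 hden),
        ENNReal.div_zero (ENNReal.ofReal_pos.2 (by linarith)).ne'] at h1
      exact not_top_lt h1
    rw [← ENNReal.ofReal_div_of_pos hden, ENNReal.ofReal_lt_ofReal_iff hα0, div_lt_iff₀ hden] at h1
    exact h1

/-! ### Minimizing over the simplex -/

/-- The bound is attained by compactness: the quotients are continuous with values in `[0, ∞]`,
since the numerators do not vanish. -/
theorem exists_isLeast_cliqueBound {δ : ℝ} (hδ₁ : 1 ≤ δ) (hδ₂ : δ < 2) {ℓ : ℕ} (hℓ : 1 ≤ ℓ) :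
    ∃ β ∈ stdSimplex ℝ (Fin ℓ),
      IsLeast (cliqueBound δ '' stdSimplex ℝ (Fin ℓ)) (cliqueBound δ β) := by
  have : Nonempty (Fin ℓ) := ⟨⟨0, hℓ⟩⟩
  have hcont : ContinuousOn (cliqueBound δ) (stdSimplex ℝ (Fin ℓ)) := by
    intro β hβ
    unfold cliqueBound ContinuousWithinAt
    simp_rw [← Finset.sup_univ_eq_iSup]
    refine Tendsto.finset_sup_nhds_apply fun i _ => ?_
    refine ENNReal.Tendsto.div ?_ (.inl ?_) ?_ (.inr ENNReal.ofReal_ne_top)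
    · have h : Continuous fun β : Fin ℓ → ℝ =>
          ENNReal.ofReal (2 * f (∑ j ∈ Finset.Iic i, β j) δ) :=
        ENNReal.continuous_ofReal.comp (continuous_const.mul
          ((continuous_f δ).comp (continuous_finsetSum _ fun j _ => continuous_apply j)))
      exact h.continuousWithinAt
    · have := f_pos hδ₁ hδ₂ (partialSum_le_one hβ (i + 1))
      rw [sum_Iic_eq_partialSum]
      exact (ENNReal.ofReal_pos.2 (by linarith)).ne'
    · have h : Continuous fun β : Fin ℓ → ℝ => ENNReal.ofReal (∑ j ∈ Finset.Ici i, β j) :=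
        ENNReal.continuous_ofReal.comp (continuous_finsetSum _ fun j _ => continuous_apply j)
      exact h.continuousWithinAt
  have hne : (stdSimplex ℝ (Fin ℓ)).Nonempty := ⟨_, single_mem_stdSimplex ℝ ⟨0, hℓ⟩⟩
  obtain ⟨β, hβ, hmin⟩ := (isCompact_stdSimplex (𝕜 := ℝ) (Fin ℓ)).exists_isMinOn hne hcont
  refine ⟨β, hβ, ⟨β, hβ, rfl⟩, ?_⟩
  rintro _ ⟨β', hβ', rfl⟩
  exact hmin hβ'

/-- The explicit choice of `β`: with `q = 1 - δ / 2`, the partial sums are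
`(q ^ (ℓ - i) - q ^ ℓ) / (1 - q ^ ℓ)`. The estimate only uses the linear bound
`f b δ ≤ 1 - q * b`. -/
theorem exists_cliqueBound_le {δ : ℝ} (hδ₁ : 1 ≤ δ) (hδ₂ : δ < 2) {ℓ : ℕ} (hℓ : 1 ≤ ℓ) :
    ∃ β ∈ stdSimplex ℝ (Fin ℓ),
      cliqueBound δ β ≤ ENNReal.ofReal (2 - δ * ((2 - δ) / 2) ^ ℓ) := by
  set q : ℝ := (2 - δ) / 2 with hq
  have hq0 : 0 < q := by linarith
  have hq1 : q < 1 := by linarith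
  have hqℓ : 0 < 1 - q ^ ℓ := by linarith [pow_lt_one₀ hq0.le hq1 (by omega : ℓ ≠ 0)]
  set B : ℕ → ℝ := fun i => (q ^ (ℓ - i) - q ^ ℓ) / (1 - q ^ ℓ) with hB
  set β : Fin ℓ → ℝ := fun j => B (j + 1) - B j with hβ
  have hpartial : ∀ i ≤ ℓ, partialSum β i = B i := by
    intro i hi
    have h1 : partialSum β i = ∑ j ∈ Finset.range i, (B (j + 1) - B j) := by
      rw [partialSum]
      refine Finset.sum_bij (fun j _ => (j : ℕ)) (fun j hj => ?_) (fun a _ b _ h => Fin.ext h)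
        (fun j hj => ?_) (fun _ _ => rfl)
      · simpa using hj
      · rw [Finset.mem_range] at hj
        exact ⟨⟨j, by omega⟩, by simpa using hj, rfl⟩
    rw [h1, Finset.sum_range_sub]
    simp [hB]
  have hmem : β ∈ stdSimplex ℝ (Fin ℓ) := by
    refine ⟨fun j => ?_, ?_⟩
    · rw [hβ]
      simp only [hB, sub_nonneg]
      have : q ^ (ℓ - j) ≤ q ^ (ℓ - (j + 1)) := pow_le_pow_of_le_one hq0.le hq1.le (by omega)
      gcongr
    · have h1 := hpartial ℓ le_rfl
      have h2 : partialSum β ℓ = ∑ j, β j := by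
        rw [partialSum]
        congr 1
        ext j
        simp
      rw [← h2, h1, hB]
      simp only [Nat.sub_self, pow_zero]
      exact div_self hqℓ.ne'
  refine ⟨β, hmem, ?_⟩
  rw [cliqueBound_eq δ hmem]
  refine iSup_le fun i => ?_
  have hi := i.isLt
  have hb1 := partialSum_le_one hmem (i + 1)
  have hb0 := partialSum_nonneg hmem (i + 1)
  have hlin := f_le_linear hδ₂ hb0 hb1
  rw [hpartial _ (by omega : (i : ℕ) + 1 ≤ ℓ)] at hlin ⊢
  rw [hpartial _ hi.le]
  set p : ℝ := q ^ (ℓ - (i + 1)) with hp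
  have hp0 : 0 < p := pow_pos hq0 _
  have hp1 : p ≤ 1 := pow_le_one₀ hq0.le hq1.le
  have hBi : 1 - B i = (1 - q * p) / (1 - q ^ ℓ) := by
    have : q ^ (ℓ - (i : ℕ)) = q * p := by
      rw [hp, ← pow_succ']
      congr 1
      omega
    simp only [hB, this]
    field_simp
    ring
  have hBi1 : B (i + 1) = (p - q ^ ℓ) / (1 - q ^ ℓ) := rfl
  have hqp : 0 < 1 - q * p := by nlinarith
  have hden : 0 < 1 - B i := by rw [hBi]; positivity
  rw [← ENNReal.ofReal_div_of_pos hden]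
  refine ENNReal.ofReal_le_ofReal ?_
  rw [div_le_iff₀ hden, hBi]
  refine (mul_le_mul_of_nonneg_left hlin (by norm_num)).trans ?_
  rw [hBi1, show δ = 2 - 2 * q by rw [hq]; ring]
  have hQ : 0 < q ^ ℓ := pow_pos hq0 ℓ
  generalize q ^ ℓ = Q at hqℓ hQ ⊢
  rw [← sub_nonneg]
  have : (2 - (2 - 2 * q) * Q) * ((1 - q * p) / (1 - Q)) -
      2 * (1 - (1 - (2 - 2 * q) / 2) * ((p - Q) / (1 - Q))) =
      (2 - 2 * q) * Q * q * p / (1 - Q) := by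
    field_simp
    ring
  rw [this]
  have : 0 < 2 - 2 * q := by linarith
  positivity

end CliqueProbing

theorem mainTheorem2 (δ : ℝ) (hδ₁ : 1 ≤ δ) (hδ₂ : δ < 2) (ℓ : ℕ) (hℓ : 1 ≤ ℓ) :
    (∃ m : ℝ≥0∞, IsLeast (CliqueProbing.cliqueBound δ '' stdSimplex ℝ (Fin ℓ)) m ∧
      CliqueProbing.alphaStar δ ℓ ≤ (m : EReal)) ∧
    (∃ β ∈ stdSimplex ℝ (Fin ℓ),
      CliqueProbing.cliqueBound δ β ≤ ENNReal.ofReal (2 - δ * ((2 - δ) / 2) ^ ℓ)) ∧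
    CliqueProbing.alphaStar δ ℓ ≤ ((2 - δ * ((2 - δ) / 2) ^ ℓ : ℝ) : EReal) := by
  refine ⟨?_, CliqueProbing.exists_cliqueBound_le hδ₁ hδ₂ hℓ, ?_⟩
  · obtain ⟨β, hβ, hmin⟩ := CliqueProbing.exists_isLeast_cliqueBound hδ₁ hδ₂ hℓ
    exact ⟨_, hmin, CliqueProbing.alphaStar_le_cliqueBound hδ₁ hδ₂ hℓ hβ⟩
  · obtain ⟨β, hβ, hle⟩ := CliqueProbing.exists_cliqueBound_le hδ₁ hδ₂ hℓ
    refine (CliqueProbing.alphaStar_le_cliqueBound hδ₁ hδ₂ hℓ hβ).trans ?_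
    refine (EReal.coe_ennreal_le_coe_ennreal_iff.2 hle).trans_eq ?_
    have hpow : ((2 - δ) / 2) ^ ℓ ≤ 1 := pow_le_one₀ (by linarith) (by linarith)
    have hpow0 : 0 ≤ ((2 - δ) / 2) ^ ℓ := pow_nonneg (by linarith) _
    rw [EReal.coe_ennreal_ofReal, max_eq_left (by nlinarith)]
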